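/- Let $n\ge 2$, let $(W,\omega)$ be a compact symplectic manifold with boundary, of dimension $2n$ (smooth up to the boundary), and let $V$ be a closed $(2n-1)$-dimensional manifold identified with $\partial W$ by a smooth embedding $V\to W$ with image $\partial W$. Let $\xi$ be a co-oriented contact structure on $V$, i.e. a co-oriented hyperplane field that is the kernel of a smooth $1$-form $\alpha$, positive on positively transverse vectors, with $d\alpha|_\xi$ nondegenerate; all such $\alpha$ are called contact forms of $\xi$. Orient $V$ by the volume forms $\alpha\wedge(d\alpha)^{n-1}$, and let $CS_\xi$ be the set of all $d\alpha|_\xi$, where $\alpha$ runs through the contact forms of $\xi$. Say that $(W,\omega)$ is a weak filling of $(V,\xi)$ if $V=\partial W$ as oriented manifolds ($W$ being oriented by $\omega^n$, and $\partial W$ by the outward normal first convention), $\omega_\xi:=\omega|_\xi$ is symplectic (nondegenerate on $\xi$ at every point), and every element of $\omega_\xi+CS_\xi$ is symplectic on $\xi$. For a smooth almost complex structure $J$ on $W$, say that $(V,\xi)$ is the tamed pseudoconvex boundary of $(W,J)$ if $V=\partial W$ as oriented manifolds ($W$ being oriented by $J$), $\xi=TV\cap J\,TV$, there is a symplectic form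 $\omega'$ on $W$ taming $J$ (i.e. $\omega'(v,Jv)>0$ for all $v\neq 0$), and $d\lambda(v,Jv)>0$ for every contact form $\lambda$ of $\xi$ and every nonzero $v\in\xi$. Then $(W,\omega)$ is a weak filling of $(V,\xi)$ if and only if there is a smooth almost complex structure $J$ on $W$ that is tamed by $\omega$ and such that $(V,\xi)$ is the tamed pseudoconvex boundary of $(W,J)$. -/

import Mathlib

open Set Module
open scoped Manifold ContDiff Topology

noncomputable section

section DifferentialForms

/-- A (not necessarily smooth) differential `m`-form on a manifold `M`, possibly with boundary. -/
abbrev DForm {E : Type*} [NormedAddCommGroup E] [NormedSpace ℝ E] {H : Type*} [TopologicalSpace H]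
    (I : ModelWithCorners ℝ E H) (M : Type*) [TopologicalSpace M] [ChartedSpace H M] (m : ℕ) :
    Type _ :=
  ∀ x : M, TangentSpace I x [⋀^Fin m]→L[ℝ] ℝ

variable {E : Type*} [NormedAddCommGroup E] [NormedSpace ℝ E] {H : Type*} [TopologicalSpace H]
  {I : ModelWithCorners ℝ E H} {M : Type*} [TopologicalSpace M] [ChartedSpace H M] {m : ℕ}

/-- The coordinate expression of a form in the chart at `x₀`: its pull-back by the inverse of the
chart, an `m`-form on (the image of the chart in) the model space. -/
def DForm.inChart (Ω : DForm I M m) (x₀ : M) (y : E) : E [⋀^Fin m]→L[ℝ] ℝ :=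
  (Ω ((extChartAt I x₀).symm y)).compContinuousLinearMap
    (mfderivWithin 𝓘(ℝ, E) I (extChartAt I x₀).symm (range I) y)

/-- A form is smooth (up to the boundary) if all its coordinate expressions are smooth. -/
def DForm.IsSmooth (Ω : DForm I M m) : Prop :=
  ∀ x₀ : M, ContDiffOn ℝ ∞ (Ω.inChart x₀) (extChartAt I x₀).target

/-- The exterior derivative of a form, computed at each point in the chart at that point. -/
def DForm.d (Ω : DForm I M m) : DForm I M (m + 1) := fun x =>
  (extDerivWithin (Ω.inChart x) (range I) (extChartAt I x x)).compContinuousLinearMap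
    (mfderiv I 𝓘(ℝ, E) (extChartAt I x) x)

/-- The pull-back of a form by a map between manifolds. -/
def DForm.pullback {E' : Type*} [NormedAddCommGroup E'] [NormedSpace ℝ E'] {H' : Type*}
    [TopologicalSpace H'] {I' : ModelWithCorners ℝ E' H'} {N : Type*} [TopologicalSpace N]
    [ChartedSpace H' N] (ι : N → M) (Ω : DForm I M m) : DForm I' N m := fun x =>
  (Ω (ι x)).compContinuousLinearMap (mfderiv I' I ι x)

/-- The restriction of the 2-form `B` to the subspace `S` is nondegenerate. -/
def NondegenerateOn {T : Type*} [AddCommGroup T] [Module ℝ T] [TopologicalSpace T]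
    (B : T [⋀^Fin 2]→L[ℝ] ℝ) (S : Submodule ℝ T) : Prop :=
  ∀ v ∈ S, (∀ w ∈ S, B ![v, w] = 0) → v = 0

/-- Symplectic forms: smooth closed nondegenerate 2-forms. -/
structure IsSymplecticForm (Ω : DForm I M 2) : Prop where
  smooth : Ω.IsSmooth
  closed : ∀ x, Ω.d x = 0
  nondegenerate : ∀ x, NondegenerateOn (Ω x) ⊤

/-- Smooth almost complex structures: smooth sections `J` of the endomorphism bundle of the tangent
bundle with `J² = -1`. -/
structure IsAlmostComplexStructure [IsManifold I ∞ M]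
    (J : ∀ x : M, TangentSpace I x →L[ℝ] TangentSpace I x) : Prop where
  smooth : ContMDiff I (I.prod 𝓘(ℝ, E →L[ℝ] E)) ∞
    (fun x => Bundle.TotalSpace.mk' (E →L[ℝ] E)
      (E := fun x : M => TangentSpace I x →L[ℝ] TangentSpace I x) x (J x))
  sq_eq_neg : ∀ (x : M) (v : TangentSpace I x), J x (J x v) = -v

/-- `J` is tamed by `Ω`: `Ω(v, J v) > 0` for all nonzero tangent vectors `v`. -/
def IsTamedBy (J : ∀ x : M, TangentSpace I x →L[ℝ] TangentSpace I x) (Ω : DForm I M 2) : Prop :=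
  ∀ (x : M) (v : TangentSpace I x), v ≠ 0 → 0 < Ω x ![v, J x v]

end DifferentialForms

section VolumeForms

variable {T : Type*} [AddCommGroup T] [Module ℝ T] [TopologicalSpace T]

/-- A positive multiple of the value `B^(k+1) (e₀, …, e_{2k+1})` of the top exterior power of the
2-form `B` on a space of dimension `2k+2`: the antisymmetrization of
`B(e₀, e₁) B(e₂, e₃) ⋯ B(e_{2k}, e_{2k+1})`. -/
def symplecticVolume (k : ℕ) (B : T [⋀^Fin 2]→L[ℝ] ℝ) (e : Fin (2 * k + 2) → T) : ℝ :=
  ∑ σ : Equiv.Perm (Fin (2 * k + 2)), ((Equiv.Perm.sign σ : ℤ) : ℝ) *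
    ∏ i : Fin (k + 1),
      B ![e (σ ⟨2 * (i : ℕ), by omega⟩), e (σ ⟨2 * (i : ℕ) + 1, by omega⟩)]

/-- A positive multiple of the value `(α ∧ B^k) (e₀, …, e_{2k})` of the exterior product of the
1-form `α` and the `k`-th exterior power of the 2-form `B` on a space of dimension `2k+1`: the
antisymmetrization of `α(e₀) B(e₁, e₂) ⋯ B(e_{2k-1}, e_{2k})`. -/
def contactVolume (k : ℕ) (α : T [⋀^Fin 1]→L[ℝ] ℝ) (B : T [⋀^Fin 2]→L[ℝ] ℝ)
    (e : Fin (2 * k + 1) → T) : ℝ :=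
  ∑ σ : Equiv.Perm (Fin (2 * k + 1)), ((Equiv.Perm.sign σ : ℤ) : ℝ) *
    (α ![e (σ 0)] * ∏ i : Fin k,
      B ![e (σ ⟨2 * (i : ℕ) + 1, by omega⟩), e (σ ⟨2 * (i : ℕ) + 2, by omega⟩)])

/-- Positively oriented frames of a complex vector space of complex dimension `k+1`, with complex
structure `J`: the complex orientation is the one given by the real bases
`v₀, J v₀, …, v_k, J v_k`. -/
def IsComplexPositive (k : ℕ) (J : T →L[ℝ] T) (e : Fin (2 * k + 2) → T) : Prop :=
  ∃ b : Basis (Fin (2 * k + 2)) ℝ T,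
    (∀ i : Fin (k + 1),
      b ⟨2 * (i : ℕ) + 1, by omega⟩ = J (b ⟨2 * (i : ℕ), by omega⟩)) ∧ 0 < b.det e

end VolumeForms

section Contact

/-- A co-oriented contact structure on a `(2k+1)`-dimensional manifold `V`: a hyperplane field with
a side of positively transverse vectors, which is the kernel of a global smooth
1-form `α`, positive on the positively transverse vectors, with `dα` nondegenerate on the kernel. -/
structure ContactStructure (k : ℕ) (V : Type*) [TopologicalSpace V]
    [ChartedSpace (EuclideanSpace ℝ (Fin (2 * k + 1))) V] where
  /-- the hyperplanes -/
  plane : ∀ x : V, Submodule ℝ (TangentSpace (𝓡 (2 * k + 1)) x)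
  /-- the positively transverse vectors -/
  posSide : ∀ x : V, Set (TangentSpace (𝓡 (2 * k + 1)) x)
  exists_form : ∃ α : DForm (𝓡 (2 * k + 1)) V 1, α.IsSmooth ∧
    (∀ x, α x ≠ 0) ∧
    (∀ x v, v ∈ plane x ↔ α x ![v] = 0) ∧
    (∀ x v, v ∈ posSide x ↔ 0 < α x ![v]) ∧
    ∀ x, NondegenerateOn (α.d x) (plane x)

variable {k : ℕ} {V : Type*} [TopologicalSpace V]
  [ChartedSpace (EuclideanSpace ℝ (Fin (2 * k + 1))) V]

/-- The smooth 1-forms defining the co-oriented hyperplane field `ξ`, i.e. its contact forms. -/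
structure ContactStructure.IsContactForm (ξ : ContactStructure k V)
    (α : DForm (𝓡 (2 * k + 1)) V 1) : Prop where
  smooth : α.IsSmooth
  mem_plane_iff : ∀ x v, v ∈ ξ.plane x ↔ α x ![v] = 0
  mem_posSide_iff : ∀ x v, v ∈ ξ.posSide x ↔ 0 < α x ![v]

/-- Positively oriented frames of `T_x V` for the orientation of `V` defined by the co-oriented
contact structure `ξ`, that is, by the volume form `α ∧ (dα)^k` for contact forms `α` of `ξ`. -/
def ContactStructure.IsPositiveFrame (ξ : ContactStructure k V) (x : V)
    (e : Fin (2 * k + 1) → TangentSpace (𝓡 (2 * k + 1)) x) : Prop :=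
  ∀ α, ξ.IsContactForm α → 0 < contactVolume k (α x) (α.d x) e

end Contact

section Boundary

variable {k : ℕ} {V : Type*} [TopologicalSpace V]
  [ChartedSpace (EuclideanSpace ℝ (Fin (2 * k + 1))) V]
  {W : Type*} [TopologicalSpace W] [ChartedSpace (EuclideanHalfSpace (2 * k + 2)) W]

/-- `ι : V → W` identifies `V` with the boundary of `W`: it is a smooth embedding with image
`∂W`. -/
structure IsBoundaryIdentification (ι : V → W) : Prop where
  isSmoothEmbedding : Manifold.IsSmoothEmbedding (𝓡 (2 * k + 1)) (𝓡∂ (2 * k + 2)) ∞ ι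
  range_eq : range ι = (𝓡∂ (2 * k + 2)).boundary W

/-- Outward pointing tangent vectors at a boundary point `p` of `W`. The charts take values in the
half space where the coordinate of index `0` is nonnegative. -/
def IsOutward (p : W) (ν : TangentSpace (𝓡∂ (2 * k + 2)) p) : Prop :=
  let u : EuclideanSpace ℝ (Fin (2 * k + 2)) :=
    mfderiv (𝓡∂ (2 * k + 2)) 𝓘(ℝ, EuclideanSpace ℝ (Fin (2 * k + 2)))
      (extChartAt (𝓡∂ (2 * k + 2)) p) p ν
  u 0 < 0

/-- `V = ∂W` as oriented manifolds, where `V` is oriented by `ξ`, the orientation of `W` is given by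
its positive frames `posW`, and the boundary is oriented by the outward normal first convention. -/
def IsOrientedBoundary (ι : V → W) (ξ : ContactStructure k V)
    (posW : ∀ p : W, (Fin (2 * k + 2) → TangentSpace (𝓡∂ (2 * k + 2)) p) → Prop) : Prop :=
  ∀ (x : V) (ν : TangentSpace (𝓡∂ (2 * k + 2)) (ι x)), IsOutward (ι x) ν →
    ∀ e : Fin (2 * k + 1) → TangentSpace (𝓡 (2 * k + 1)) x,
      ξ.IsPositiveFrame x e ↔
        posW (ι x) (Fin.cons ν fun i => mfderiv (𝓡 (2 * k + 1)) (𝓡∂ (2 * k + 2)) ι x (e i))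

/-- `(W, Ω)` is a weak filling of `(V, ξ)`, with `V` identified with `∂W` by `ι`: the orientations
match, the restriction `Ω_ξ` is symplectic on `ξ`, and so is every element `Ω_ξ + dα|ξ` of
`Ω_ξ + CS_ξ`, where `CS_ξ` is the set of all `dα|ξ` for contact forms `α` of `ξ`. -/
structure IsWeakFilling (ι : V → W) (Ω : DForm (𝓡∂ (2 * k + 2)) W 2)
    (ξ : ContactStructure k V) : Prop where
  oriented : IsOrientedBoundary ι ξ fun p e => 0 < symplecticVolume k (Ω p) e
  nondegenerate : ∀ x, NondegenerateOn
    (DForm.pullback (I' := 𝓡 (2 * k + 1)) ι Ω x) (ξ.plane x)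
  nondegenerate_add : ∀ α, ξ.IsContactForm α → ∀ x, NondegenerateOn
    (DForm.pullback (I' := 𝓡 (2 * k + 1)) ι Ω x + α.d x) (ξ.plane x)

/-- `(V, ξ)` is the tamed pseudoconvex boundary of `(W, J)`, with `V` identified with `∂W` by `ι`:
the orientations match, where `W` carries the complex orientation; `ξ = TV ∩ J TV`;
`W` admits a symplectic form taming `J`; and `V` is `J`-convex, i.e. `dλ(v, J v) > 0` for every
contact form `λ` of `ξ` and every nonzero `v ∈ ξ`. In the last clause `w` is the vector tangent to
`V` that is `J v`. -/
structure IsTamedPseudoconvexBoundary (ι : V → W)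
    (J : ∀ p : W, TangentSpace (𝓡∂ (2 * k + 2)) p →L[ℝ] TangentSpace (𝓡∂ (2 * k + 2)) p)
    (ξ : ContactStructure k V) : Prop where
  oriented : IsOrientedBoundary ι ξ fun p e => IsComplexPositive k (J p) e
  complex_tangencies : ∀ x : V,
    (ξ.plane x).map (mfderiv (𝓡 (2 * k + 1)) (𝓡∂ (2 * k + 2)) ι x).toLinearMap =
      (mfderiv (𝓡 (2 * k + 1)) (𝓡∂ (2 * k + 2)) ι x).toLinearMap.range ⊓
        (mfderiv (𝓡 (2 * k + 1)) (𝓡∂ (2 * k + 2)) ι x).toLinearMap.range.map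
          (J (ι x)).toLinearMap
  tamed : ∃ Ω' : DForm (𝓡∂ (2 * k + 2)) W 2, IsSymplecticForm Ω' ∧ IsTamedBy J Ω'
  convex : ∀ l, ξ.IsContactForm l → ∀ x, ∀ v ∈ ξ.plane x, v ≠ 0 →
    ∃ w ∈ ξ.plane x,
      mfderiv (𝓡 (2 * k + 1)) (𝓡∂ (2 * k + 2)) ι x w =
        J (ι x) (mfderiv (𝓡 (2 * k + 1)) (𝓡∂ (2 * k + 2)) ι x v) ∧
      0 < l.d x ![v, w]

end Boundary

end

/-!
At every point of `W`, the endomorphisms `K` of the tangent space which are tamed by `ω` and, on the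
boundary, preserve `ξ` and are tamed there by `dα` form a convex set, so local smooth fields of such
endomorphisms can be glued by a partition of unity. At a boundary point they exist because all the
forms on the segment from `ω|ξ` to `dα|ξ` are nondegenerate on `ξ`: otherwise Gordan's alternative,
applied to the conditions `B₀ (v, K v) > 0` and `B₁ (v, K v) > 0`, yields positive operators `P` and
`Q` with `B₀ P + B₁ Q = 0`, and an extremal vector of the pencil of `P` and `Q` lies in the kernel
of a form on the segment. On the `ω`-orthogonal complement of `ξ`, only `ω` matters.

The glued field `K` has no real eigenvalues. Averaging it over the group of Möbius transformations
`K ↦ (cos θ K + sin θ) (cos θ - sin θ K)⁻¹`, which fix `±i`, produces a complex structure `J`. The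
average keeps the invariant subspaces of `K` and stays tamed by every form that tames `K`, since
`B (cos θ u - sin θ K u, cos θ K u + sin θ u) = B (u, K u)` for every alternating `B`.

Conversely, if `v ≠ 0` lies in `ξ`, then `J v` pairs positively with `v` under both `ω` and `dα`, so
that neither `ω` nor `ω + dα` degenerates on `ξ`. The two orientations of `W` agree because a form
taming `J` is positive on complex bases.
-/

noncomputable section

section CayleyAverage

open scoped Real

variable {A : Type*} [NormedRing A] [NormedAlgebra ℝ A]

/-- The denominators of the rotations `X ↦ (cos θ X + sin θ) (cos θ - sin θ X)⁻¹`. -/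
def rotDen (X : A) (θ : ℝ) : A := Real.cos θ • (1 : A) - Real.sin θ • X

/-- The numerators of the rotations `X ↦ (cos θ X + sin θ) (cos θ - sin θ X)⁻¹`. -/
def rotNum (X : A) (θ : ℝ) : A := Real.cos θ • X + Real.sin θ • (1 : A)

/-- The orbit of `X` under the rotations `X ↦ (cos θ X + sin θ) (cos θ - sin θ X)⁻¹`, which are the
Möbius transformations fixing `i` and `-i`. It is meaningful only if `rotDen X θ` is invertible. -/
def rot (X : A) (θ : ℝ) : A := rotNum X θ * Ring.inverse (rotDen X θ)

/-- The elements all of whose rotations are defined: those without real spectrum. -/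
def IsRotatable (X : A) : Prop := ∀ θ, IsUnit (rotDen X θ)

/-- The average of `X` over the group of Möbius transformations fixing `i` and `-i`, which has
period `π`. -/
def rotAvg (X : A) : A := (1 / π) • ∫ θ in 0..π, rot X θ

lemma continuous_rotDen (X : A) : Continuous (rotDen X) := by
  unfold rotDen; fun_prop

lemma continuous_rotNum (X : A) : Continuous (rotNum X) := by
  unfold rotNum; fun_prop

lemma rotDen_add_pi (X : A) (θ : ℝ) : rotDen X (θ + π) = -rotDen X θ := by
  simp only [rotDen, Real.cos_add_pi, Real.sin_add_pi]; module

lemma rotNum_add_pi (X : A) (θ : ℝ) : rotNum X (θ + π) = -rotNum X θ := by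
  simp only [rotNum, Real.cos_add_pi, Real.sin_add_pi]; module

lemma commute_rotDen_rotNum (X : A) (θ φ : ℝ) : Commute (rotDen X θ) (rotNum X φ) := by
  simp only [Commute, SemiconjBy, rotDen, rotNum, sub_mul, mul_add, mul_sub, add_mul,
    smul_mul_assoc, mul_smul_comm, one_mul, mul_one]
  module

namespace IsRotatable

variable {X : A}

lemma rot_mul_rotDen (hX : IsRotatable X) (θ : ℝ) : rot X θ * rotDen X θ = rotNum X θ := by
  rw [rot, mul_assoc, Ring.inverse_mul_cancel _ (hX θ), mul_one]

lemma rotDen_mul_rot (hX : IsRotatable X) (θ : ℝ) : rotDen X θ * rot X θ = rotNum X θ := by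
  rw [rot, ← mul_assoc, (commute_rotDen_rotNum X θ θ).eq, mul_assoc,
    Ring.mul_inverse_cancel _ (hX θ), mul_one]

lemma periodic_rot (hX : IsRotatable X) : Function.Periodic (rot X) π := by
  intro θ
  have h := hX.rot_mul_rotDen (θ + π)
  rw [rotDen_add_pi, rotNum_add_pi, mul_neg, neg_inj, ← hX.rot_mul_rotDen θ] at h
  exact (hX θ).mul_left_injective h

end IsRotatable

lemma sin_smul_rotNum_mul_rotNum (X : A) (θ φ : ℝ) :
    Real.sin φ • (rotNum X θ * rotNum X (θ + φ)) =
      Real.cos φ • (rotDen X θ * rotNum X (θ + φ) - rotNum X θ * rotDen X (θ + φ)) -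
        Real.sin φ • (rotDen X θ * rotDen X (θ + φ)) := by
  have hcos : Real.cos (θ + φ) * Real.cos θ + Real.sin (θ + φ) * Real.sin θ = Real.cos φ := by
    rw [← Real.cos_sub, add_sub_cancel_left]
  have hsin : Real.sin (θ + φ) * Real.cos θ - Real.cos (θ + φ) * Real.sin θ = Real.sin φ := by
    rw [← Real.sin_sub, add_sub_cancel_left]
  rw [← hcos, ← hsin]
  simp only [rotDen, rotNum, sub_mul, mul_add, mul_sub, add_mul,
    smul_mul_assoc, mul_smul_comm, one_mul, mul_one]
  module

namespace IsRotatable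

variable {X : A}

/-- The subtraction formula for the cotangent, of which `θ ↦ rot X θ` is a translate. -/
lemma sin_smul_rot_mul_rot (hX : IsRotatable X) (θ φ : ℝ) :
    Real.sin φ • (rot X θ * rot X (θ + φ)) =
      Real.cos φ • (rot X (θ + φ) - rot X θ) - Real.sin φ • (1 : A) := by
  have hnum : rotDen X θ * (Real.sin φ • (rot X θ * rot X (θ + φ))) * rotDen X (θ + φ) =
      Real.sin φ • (rotNum X θ * rotNum X (θ + φ)) := by
    rw [mul_smul_comm, smul_mul_assoc, ← mul_assoc, hX.rotDen_mul_rot, mul_assoc,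
      hX.rot_mul_rotDen]
  rw [← (hX θ).mul_right_inj, ← (hX (θ + φ)).mul_left_inj, hnum, sin_smul_rotNum_mul_rotNum]
  simp only [mul_sub, sub_mul, mul_smul_comm, smul_mul_assoc, mul_one]
  rw [mul_assoc _ (rot X (θ + φ)), hX.rot_mul_rotDen, hX.rotDen_mul_rot]

lemma integral_rot_add (hX : IsRotatable X) (φ : ℝ) :
    ∫ θ in 0..π, rot X (θ + φ) = ∫ θ in 0..π, rot X θ := by
  rw [intervalIntegral.integral_comp_add_right, zero_add, add_comm,
    hX.periodic_rot.intervalIntegral_add_eq φ 0, zero_add]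

variable [CompleteSpace A]

lemma continuous_rot (hX : IsRotatable X) : Continuous (rot X) := by
  refine (continuous_rotNum X).mul (continuous_iff_continuousAt.2 fun θ => ?_)
  obtain ⟨u, hu⟩ := hX θ
  exact ContinuousAt.comp (f := rotDen X) (hu ▸ NormedRing.inverse_continuousAt u)
    (continuous_rotDen X).continuousAt

lemma integral_rot_mul_rot_add (hX : IsRotatable X) {φ : ℝ} (hφ : Real.sin φ ≠ 0) :
    ∫ θ in 0..π, rot X θ * rot X (θ + φ) = -(π • (1 : A)) := by
  have hc := hX.continuous_rot
  have hc' : Continuous fun θ => rot X (θ + φ) := hc.comp (by fun_prop)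
  refine smul_right_injective A hφ ?_
  dsimp only
  rw [← intervalIntegral.integral_smul]
  simp_rw [hX.sin_smul_rot_mul_rot]
  rw [intervalIntegral.integral_sub, intervalIntegral.integral_smul,
    intervalIntegral.integral_sub (hc'.intervalIntegrable _ _) (hc.intervalIntegrable _ _),
    hX.integral_rot_add, sub_self, smul_zero, zero_sub, intervalIntegral.integral_const,
    sub_zero, smul_comm, smul_neg]
  · exact ((hc'.sub hc).const_smul _).intervalIntegrable _ _
  · exact continuous_const.intervalIntegrable _ _

lemma integral_rot_mul_integral_rot (hX : IsRotatable X) :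
    (∫ θ in 0..π, rot X θ) * (∫ θ in 0..π, rot X θ) =
      ∫ φ in 0..π, ∫ θ in 0..π, rot X θ * rot X (θ + φ) := by
  have hc := hX.continuous_rot
  have hcc : Continuous (Function.uncurry fun θ φ => rot X θ * rot X (θ + φ)) :=
    (hc.comp continuous_fst).mul (hc.comp (continuous_fst.add continuous_snd))
  calc (∫ θ in 0..π, rot X θ) * (∫ θ in 0..π, rot X θ)
      = ∫ θ in 0..π, rot X θ * ∫ φ in 0..π, rot X φ :=
        (((ContinuousLinearMap.mul ℝ A).flip _).intervalIntegral_comp_comm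
          (hc.intervalIntegrable _ _)).symm
    _ = ∫ θ in 0..π, ∫ φ in 0..π, rot X θ * rot X (θ + φ) := by
        congr 1 with θ
        have hshift : ∫ φ in 0..π, rot X φ = ∫ φ in 0..π, rot X (θ + φ) := by
          simp_rw [← hX.integral_rot_add θ, add_comm]
        rw [hshift]
        exact ((ContinuousLinearMap.mul ℝ A (rot X θ)).intervalIntegral_comp_comm
          ((hc.comp (by fun_prop)).intervalIntegrable _ _)).symm
    _ = ∫ φ in 0..π, ∫ θ in 0..π, rot X θ * rot X (θ + φ) :=
        MeasureTheory.intervalIntegral_intervalIntegral_swap <|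
          (hcc.continuousOn.integrableOn_compact (isCompact_uIcc.prod isCompact_uIcc)).mono_set
            (prod_mono uIoc_subset_uIcc uIoc_subset_uIcc)

theorem rotAvg_mul_self (hX : IsRotatable X) : rotAvg X * rotAvg X = -1 := by
  have hinner : ∫ φ in 0..π, ∫ θ in 0..π, rot X θ * rot X (θ + φ) =
      ∫ _ in 0..π, -(π • (1 : A)) := by
    simp only [intervalIntegral.integral_of_le Real.pi_pos.le,
      MeasureTheory.integral_Ioc_eq_integral_Ioo]
    refine MeasureTheory.setIntegral_congr_fun measurableSet_Ioo fun φ hφ => ?_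
    have := hX.integral_rot_mul_rot_add (Real.sin_pos_of_mem_Ioo hφ).ne'
    rwa [intervalIntegral.integral_of_le Real.pi_pos.le,
      MeasureTheory.integral_Ioc_eq_integral_Ioo] at this
  have hπ : 1 / π * (1 / π) * π * π = 1 := by field_simp
  rw [rotAvg, smul_mul_smul_comm, hX.integral_rot_mul_integral_rot, hinner,
    intervalIntegral.integral_const, sub_zero, smul_neg, smul_neg, smul_smul, smul_smul, hπ,
    one_smul]

lemma apply_rotAvg {F : Type*} [NormedAddCommGroup F] [NormedSpace ℝ F] [CompleteSpace F]
    (hX : IsRotatable X) (f : A →L[ℝ] F) :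
    f (rotAvg X) = (1 / π) • ∫ θ in 0..π, f (rot X θ) := by
  rw [rotAvg, map_smul, f.intervalIntegral_comp_comm (hX.continuous_rot.intervalIntegrable _ _)]

end IsRotatable

lemma map_ringInverse {R S F : Type*} [MonoidWithZero R] [MonoidWithZero S] [FunLike F R S]
    [MonoidHomClass F R S] (f : F) {x : R} (hx : IsUnit x) :
    f (Ring.inverse x) = Ring.inverse (f x) := by
  obtain ⟨u, rfl⟩ := hx
  rw [Ring.inverse_unit]
  exact (Ring.inverse_unit (Units.map (f : R →* S) u)).symm

section Naturality

variable {B : Type*} [NormedRing B] [NormedAlgebra ℝ B]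

lemma map_rotDen (f : A →ₐ[ℝ] B) (X : A) (θ : ℝ) : f (rotDen X θ) = rotDen (f X) θ := by
  simp only [rotDen, map_sub, map_smul, map_one]

lemma map_rotNum (f : A →ₐ[ℝ] B) (X : A) (θ : ℝ) : f (rotNum X θ) = rotNum (f X) θ := by
  simp only [rotNum, map_add, map_smul, map_one]

variable {X : A}

lemma IsRotatable.map (hX : IsRotatable X) (f : A →ₐ[ℝ] B) : IsRotatable (f X) := fun θ =>
  map_rotDen f X θ ▸ (hX θ).map f

lemma IsRotatable.map_rot (hX : IsRotatable X) (f : A →ₐ[ℝ] B) (θ : ℝ) :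
    f (rot X θ) = rot (f X) θ := by
  rw [rot, map_mul, map_ringInverse f (hX θ), map_rotNum, map_rotDen, rot]

lemma IsRotatable.map_rotAvg [CompleteSpace A] [CompleteSpace B] (hX : IsRotatable X)
    (f : A →ₐ[ℝ] B) (hf : Continuous f) : f (rotAvg X) = rotAvg (f X) := by
  rw [rotAvg.eq_def (f X)]
  simp_rw [← hX.map_rot f]
  exact hX.apply_rotAvg (⟨f.toLinearMap, hf⟩ : A →L[ℝ] B)

end Naturality

section Smoothness

/-- Integration over `[0, π]` as a continuous linear map on continuous functions. -/
def integralZeroPiCLM : C(Icc (0 : ℝ) π, A) →L[ℝ] A :=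
  LinearMap.mkContinuous
    { toFun := fun f => ∫ θ in 0..π, IccExtend Real.pi_pos.le f θ
      map_add' := fun f g => intervalIntegral.integral_add
        (f.continuous.Icc_extend'.intervalIntegrable _ _)
        (g.continuous.Icc_extend'.intervalIntegrable _ _)
      map_smul' := fun c f => intervalIntegral.integral_smul c (IccExtend Real.pi_pos.le f) }
    π fun f => by
      have := intervalIntegral.norm_integral_le_of_norm_le_const (a := 0) (b := π) (C := ‖f‖)
        (f := IccExtend Real.pi_pos.le f) fun θ _ => f.norm_coe_le_norm _
      rwa [sub_zero, abs_of_pos Real.pi_pos, mul_comm] at this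

lemma integralZeroPiCLM_apply_eq {f : C(Icc (0 : ℝ) π, A)} {g : ℝ → A} (hfg : ∀ θ, f θ = g θ) :
    integralZeroPiCLM f = ∫ θ in 0..π, g θ := by
  refine intervalIntegral.integral_congr fun θ hθ => ?_
  rw [uIcc_of_le Real.pi_pos.le] at hθ
  exact (IccExtend_of_mem _ _ hθ).trans (hfg ⟨θ, hθ⟩)

/-- The path `θ ↦ rotDen X θ`, `0 ≤ θ ≤ π`. -/
def rotDenPath (X : A) : C(Icc (0 : ℝ) π, A) :=
  ⟨fun θ => rotDen X θ, (continuous_rotDen X).comp continuous_subtype_val⟩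

/-- The path `θ ↦ rotNum X θ`, `0 ≤ θ ≤ π`. -/
def rotNumPath (X : A) : C(Icc (0 : ℝ) π, A) :=
  ⟨fun θ => rotNum X θ, (continuous_rotNum X).comp continuous_subtype_val⟩

lemma contDiff_rotDenPath : ContDiff ℝ ∞ (rotDenPath : A → C(Icc (0 : ℝ) π, A)) := by
  let sinPath : C(Icc (0 : ℝ) π, A) := ⟨fun θ => Real.sin θ • (1 : A), by fun_prop⟩
  have h : (rotDenPath : A → C(Icc (0 : ℝ) π, A)) =
      fun X => rotDenPath 0 - sinPath * ContinuousLinearMap.const ℝ (Icc (0 : ℝ) π) X := by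
    ext X θ
    simp [rotDenPath, rotDen, sinPath]
  exact h ▸ contDiff_const.sub (contDiff_const.mul (ContinuousLinearMap.contDiff _))

lemma contDiff_rotNumPath : ContDiff ℝ ∞ (rotNumPath : A → C(Icc (0 : ℝ) π, A)) := by
  let cosPath : C(Icc (0 : ℝ) π, A) := ⟨fun θ => Real.cos θ • (1 : A), by fun_prop⟩
  have h : (rotNumPath : A → C(Icc (0 : ℝ) π, A)) =
      fun X => cosPath * ContinuousLinearMap.const ℝ (Icc (0 : ℝ) π) X + rotNumPath 0 := by
    ext X θ
    simp [rotNumPath, rotNum, cosPath]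
  exact h ▸ (contDiff_const.mul (ContinuousLinearMap.contDiff _)).add contDiff_const

lemma rotAvg_eq_integralZeroPiCLM {X : A} (hX : IsUnit (rotDenPath X)) :
    rotAvg X = (1 / π) • integralZeroPiCLM (rotNumPath X * Ring.inverse (rotDenPath X)) := by
  refine congrArg ((1 / π) • ·) (integralZeroPiCLM_apply_eq fun θ => ?_).symm
  let evalAt : C(Icc (0 : ℝ) π, A) →* A :=
    (Pi.evalMonoidHom (fun _ => A) θ).comp ContinuousMap.coeFnMonoidHom
  exact congrArg (rotNum X θ * ·) (map_ringInverse evalAt hX)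

theorem IsRotatable.contDiffAt_rotAvg [CompleteSpace A] {X : A} (hX : IsRotatable X) :
    ContDiffAt ℝ ∞ (rotAvg : A → A) X := by
  have hunit : IsUnit (rotDenPath X) :=
    (ContinuousMap.isUnit_iff_forall_isUnit _).2 fun θ => hX θ
  have hev : ∀ᶠ Y in 𝓝 X, IsUnit (rotDenPath Y) :=
    contDiff_rotDenPath.continuous.continuousAt.eventually (Units.isOpen.mem_nhds hunit)
  have hinv : ContDiffAt ℝ ∞ Ring.inverse (rotDenPath X) := by
    obtain ⟨u, hu⟩ := hunit
    exact hu ▸ contDiffAt_ringInverse ℝ u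
  refine ContDiffAt.congr_of_eventuallyEq ?_ (hev.mono fun Y hY => rotAvg_eq_integralZeroPiCLM hY)
  exact (((integralZeroPiCLM (A := A)).contDiff.contDiffAt.comp X
    (contDiff_rotNumPath.contDiffAt.mul
      (hinv.comp X contDiff_rotDenPath.contDiffAt))).const_smul (1 / π))

end Smoothness

end CayleyAverage

section Endomorphisms

open scoped Real

variable {E : Type*} [NormedAddCommGroup E] [NormedSpace ℝ E]
  {K : E →L[ℝ] E} {S : Submodule ℝ E} {B : E →ₗ[ℝ] E →ₗ[ℝ] ℝ} {v : E}

lemma rotDen_apply (K : E →L[ℝ] E) (θ : ℝ) (v : E) :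
    rotDen K θ v = Real.cos θ • v - Real.sin θ • K v := rfl

lemma rotNum_apply (K : E →L[ℝ] E) (θ : ℝ) (v : E) :
    rotNum K θ v = Real.cos θ • K v + Real.sin θ • v := rfl

lemma alt_rotDen_rotNum (hB : B.IsAlt) (K : E →L[ℝ] E) (θ : ℝ) (u : E) :
    B (rotDen K θ u) (rotNum K θ u) = B u (K u) := by
  simp only [rotDen_apply, rotNum_apply, map_sub, map_add, map_smul, LinearMap.sub_apply,
    LinearMap.smul_apply, hB.self_eq_zero, smul_eq_mul, ← hB.neg (K u) u]
  linear_combination (-(B (K u) u)) * Real.sin_sq_add_cos_sq θ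

lemma IsRotatable.rot_apply_rotDen (hK : IsRotatable K) (θ : ℝ) (u : E) :
    rot K θ (rotDen K θ u) = rotNum K θ u :=
  congrArg (fun L : E →L[ℝ] E => L u) (hK.rot_mul_rotDen θ)

variable [FiniteDimensional ℝ E]

lemma isRotatable_of_tame (hB : B.IsAlt) (hK : ∀ v, v ≠ 0 → 0 < B v (K v)) :
    IsRotatable K := by
  intro θ
  have hinj : Function.Injective (rotDen K θ : E →L[ℝ] E) := by
    rw [injective_iff_map_eq_zero]
    intro v hv
    by_contra hne
    have heq : Real.cos θ • v = Real.sin θ • K v := sub_eq_zero.1 hv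
    have hsin : Real.sin θ = 0 := by
      simpa [hB.self_eq_zero v, (hK v hne).ne'] using (congrArg (B v) heq).symm
    have hcos : Real.cos θ = 0 := by
      simpa [hB.self_eq_zero (K v), (hK v hne).ne'] using congrArg (fun w => B w (K v)) heq
    simpa [hsin, hcos] using Real.sin_sq_add_cos_sq θ
  rw [ContinuousLinearMap.isUnit_iff_bijective]
  exact ⟨hinj, (rotDen K θ).toLinearMap.injective_iff_surjective.1 hinj⟩

namespace IsRotatable

lemma exists_rotDen_apply_eq (hK : IsRotatable K) (hS : ∀ v ∈ S, K v ∈ S) (hv : v ∈ S) (θ : ℝ) :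
    ∃ u ∈ S, rotDen K θ u = v := by
  have hmaps : ∀ v ∈ S, rotDen K θ v ∈ S := fun v hv =>
    S.sub_mem (S.smul_mem _ hv) (S.smul_mem _ (hS v hv))
  have hinj : Function.Injective ((rotDen K θ).toLinearMap.restrict hmaps) := fun x y hxy =>
    Subtype.ext ((ContinuousLinearMap.isUnit_iff_bijective.1 (hK θ)).1 (congrArg Subtype.val hxy))
  obtain ⟨u, hu⟩ := LinearMap.injective_iff_surjective.1 hinj ⟨v, hv⟩
  exact ⟨u, u.2, congrArg Subtype.val hu⟩

lemma rot_apply_mem (hK : IsRotatable K) (hS : ∀ v ∈ S, K v ∈ S) (hv : v ∈ S) (θ : ℝ) :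
    rot K θ v ∈ S := by
  obtain ⟨u, hu, rfl⟩ := hK.exists_rotDen_apply_eq hS hv θ
  rw [hK.rot_apply_rotDen]
  exact S.add_mem (S.smul_mem _ (hS u hu)) (S.smul_mem _ hu)

lemma continuous_map_rot_apply (hK : IsRotatable K) (f : E →ₗ[ℝ] ℝ) (v : E) :
    Continuous fun θ => f (rot K θ v) :=
  f.continuous_of_finiteDimensional.comp
    ((ContinuousLinearMap.apply ℝ E v).continuous.comp hK.continuous_rot)

lemma map_rotAvg_apply (hK : IsRotatable K) (f : E →ₗ[ℝ] ℝ) (v : E) :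
    f (rotAvg K v) = (1 / π) * ∫ θ in 0..π, f (rot K θ v) :=
  hK.apply_rotAvg (f.toContinuousLinearMap.comp (ContinuousLinearMap.apply ℝ E v))

lemma rotAvg_apply_mem (hK : IsRotatable K) (hS : ∀ v ∈ S, K v ∈ S) (hv : v ∈ S) :
    rotAvg K v ∈ S := by
  by_contra hne
  obtain ⟨f, hf, hfS⟩ := Submodule.exists_le_ker_of_notMem hne
  refine hf ?_
  have hzero : ∀ θ, f (rot K θ v) = 0 := fun θ => hfS (hK.rot_apply_mem hS hv θ)
  simp only [hK.map_rotAvg_apply, hzero, intervalIntegral.integral_zero, mul_zero]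

theorem rotAvg_tame (hK : IsRotatable K) (hS : ∀ v ∈ S, K v ∈ S) (hB : B.IsAlt)
    (hBK : ∀ v ∈ S, v ≠ 0 → 0 < B v (K v)) (hv : v ∈ S) (hv0 : v ≠ 0) :
    0 < B v (rotAvg K v) := by
  rw [hK.map_rotAvg_apply]
  refine mul_pos (by positivity) (intervalIntegral.intervalIntegral_pos_of_pos
    ((hK.continuous_map_rot_apply (B v) v).intervalIntegrable _ _) (fun θ => ?_) Real.pi_pos)
  obtain ⟨u, hu, rfl⟩ := hK.exists_rotDen_apply_eq hS hv θ
  rw [hK.rot_apply_rotDen, alt_rotDen_rotNum hB]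
  exact hBK u hu (by rintro rfl; exact hv0 (map_zero _))

end IsRotatable

end Endomorphisms

section Gordan

variable {F : Type*} [NormedAddCommGroup F] [NormedSpace ℝ F]

lemma convexHull_range_eq_image_stdSimplex {κ : Type*} [Fintype κ] (z : κ → F) :
    convexHull ℝ (range z) = (fun w : κ → ℝ => ∑ i, w i • z i) '' stdSimplex ℝ κ := by
  classical
  have hz : z = Fintype.linearCombination ℝ z ∘ fun i j : κ => if i = j then (1 : ℝ) else 0 := by
    ext i
    simp [Fintype.linearCombination_apply]
  have h := (Fintype.linearCombination ℝ z).image_convexHull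
    (range fun i j : κ => if i = j then (1 : ℝ) else 0)
  rw [convexHull_basis_eq_stdSimplex, ← range_comp, ← hz] at h
  exact h.symm

variable [FiniteDimensional ℝ F]

lemma convexHull_eq_image_stdSimplex_prod (s : Set F) :
    convexHull ℝ s = (fun p : (Fin (finrank ℝ F + 1) → ℝ) × (Fin (finrank ℝ F + 1) → F) =>
      ∑ i, p.1 i • p.2 i) '' (stdSimplex ℝ _ ×ˢ univ.pi fun _ => s) := by
  ext x
  constructor
  · intro hx
    rw [convexHull_eq_union] at hx
    simp only [mem_iUnion, exists_prop] at hx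
    obtain ⟨t, hts, hind, hxt⟩ := hx
    have : Nonempty t := (convexHull_nonempty_iff.1 ⟨x, hxt⟩).to_subtype
    have hcard : Fintype.card t ≤ Fintype.card (Fin (finrank ℝ F + 1)) := by
      simpa only [Fintype.card_fin] using
        hind.card_le_finrank_succ.trans (Nat.succ_le_succ (Submodule.finrank_le _))
    obtain ⟨e⟩ := Function.Embedding.nonempty_of_card_le hcard
    let z : Fin (finrank ℝ F + 1) → F := Subtype.val ∘ Function.invFun e
    have hz : range z = t := by
      rw [range_comp, (Function.invFun_surjective e.injective).range_eq, image_univ,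
        Subtype.range_coe]
    rw [← hz, convexHull_range_eq_image_stdSimplex] at hxt
    obtain ⟨w, hw, rfl⟩ := hxt
    exact ⟨(w, z), ⟨hw, fun i _ => hts (hz ▸ mem_range_self i)⟩, rfl⟩
  · rintro ⟨⟨w, z⟩, ⟨hw, hz⟩, rfl⟩
    have hzs : range z ⊆ s := range_subset_iff.2 fun i => hz i (mem_univ i)
    exact convexHull_mono hzs (convexHull_range_eq_image_stdSimplex z ▸ mem_image_of_mem _ hw)

lemma isCompact_convexHull {s : Set F} (hs : IsCompact s) : IsCompact (convexHull ℝ s) := by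
  rw [convexHull_eq_image_stdSimplex_prod]
  exact ((isCompact_stdSimplex ℝ _).prod (isCompact_univ_pi fun _ => hs)).image (by fun_prop)

/-- Gordan's alternative for a compact set of linear functionals. -/
theorem exists_forall_pos_of_zero_notMem_convexHull {D : Set (F →L[ℝ] ℝ)} (hD : IsCompact D)
    (h0 : 0 ∉ convexHull ℝ D) : ∃ x : F, ∀ ψ ∈ D, 0 < ψ x := by
  obtain ⟨f, u, hu, hf⟩ := geometric_hahn_banach_point_closed (convex_convexHull ℝ D)
    (isCompact_convexHull hD).isClosed h0
  rw [map_zero] at hu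
  let f' : Dual ℝ (Dual ℝ F) :=
    f.toLinearMap ∘ₗ (LinearMap.toContinuousLinearMap (𝕜 := ℝ) (E := F) (F' := ℝ)).toLinearMap
  refine ⟨(evalEquiv ℝ F).symm f', fun ψ hψ => ?_⟩
  calc 0 < f ψ := hu.trans (hf ψ (subset_convexHull ℝ D hψ))
    _ = ψ ((evalEquiv ℝ F).symm f') := (apply_evalEquiv_symm_apply ℝ F ψ.toLinearMap f').symm

end Gordan

section PositivePencils

open scoped RealInnerProductSpace

variable {T : Type*} [NormedAddCommGroup T] [InnerProductSpace ℝ T] {P Q : T →ₗ[ℝ] T}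

lemma apply_eq_zero_of_inner_apply_self_eq_zero (hP : P.IsPositive) {x : T} (hx : ⟪P x, x⟫ = 0) :
    P x = 0 := by
  let form : LinearMap.BilinForm ℝ T := (innerₗ T).comp P
  have hsymm : LinearMap.IsSymm form :=
    ⟨fun x y => (hP.isSymmetric x y).trans (real_inner_comm _ _)⟩
  have hker := (form.apply_apply_same_eq_zero_iff hP.inner_nonneg_left hsymm).1 hx
  exact inner_self_eq_zero.1 (LinearMap.congr_fun hker (P x))

lemma inner_apply_self_pos_of_mem_ker_orthogonal (hP : P.IsPositive) {m : T} (hm : m ∈ P.kerᗮ)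
    (hm0 : m ≠ 0) : 0 < ⟪P m, m⟫ :=
  (hP.inner_nonneg_left m).lt_of_ne fun h =>
    hm0 (inner_self_eq_zero.1 (hm m (apply_eq_zero_of_inner_apply_self_eq_zero hP h.symm)))

variable [FiniteDimensional ℝ T]

lemma exists_forall_inner_apply_le (hP : P.IsPositive) (hP0 : P ≠ 0) (Q : T →ₗ[ℝ] T) :
    ∃ m ∈ P.kerᗮ, m ≠ 0 ∧ ∀ n ∈ P.kerᗮ, ⟪Q n, n⟫ ≤ ⟪Q m, m⟫ / ⟪P m, m⟫ * ⟪P n, n⟫ := by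
  let s : Set T := Metric.sphere 0 1 ∩ P.kerᗮ
  have hs : IsCompact s := (isCompact_sphere 0 1).inter_right P.kerᗮ.closed_of_finiteDimensional
  have hs0 : ∀ m ∈ s, m ≠ 0 := fun m hm => ne_zero_of_mem_unit_sphere ⟨m, hm.1⟩
  have hmem : ∀ n ∈ P.kerᗮ, n ≠ 0 → ‖n‖⁻¹ • n ∈ s := fun n hn hn0 =>
    ⟨mem_sphere_zero_iff_norm.2 (norm_smul_inv_norm hn0), P.kerᗮ.smul_mem _ hn⟩
  have hne : s.Nonempty := by
    have hbot : P.kerᗮ ≠ ⊥ := fun h =>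
      hP0 (LinearMap.ker_eq_top.1 (Submodule.orthogonal_eq_bot_iff.1 h))
    obtain ⟨n, hn, hn0⟩ := Submodule.exists_mem_ne_zero_of_ne_bot hbot
    exact ⟨_, hmem n hn hn0⟩
  have hcont : ∀ L : T →ₗ[ℝ] T, Continuous fun m => ⟪L m, m⟫ := fun L =>
    L.continuous_of_finiteDimensional.inner continuous_id
  obtain ⟨m, hm, hmax⟩ := hs.exists_isMaxOn hne (f := fun m => ⟪Q m, m⟫ / ⟪P m, m⟫)
    ((hcont Q).continuousOn.div (hcont P).continuousOn fun m hm =>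
      (inner_apply_self_pos_of_mem_ker_orthogonal hP hm.2 (hs0 m hm)).ne')
  refine ⟨m, hm.2, hs0 m hm, fun n hn => ?_⟩
  obtain rfl | hn0 := eq_or_ne n 0
  · simp only [map_zero, inner_zero_left, mul_zero, le_refl]
  have hle : ⟪Q (‖n‖⁻¹ • n), ‖n‖⁻¹ • n⟫ / ⟪P (‖n‖⁻¹ • n), ‖n‖⁻¹ • n⟫ ≤ ⟪Q m, m⟫ / ⟪P m, m⟫ :=
    hmax (hmem n hn hn0)
  have hnorm : ‖n‖⁻¹ ≠ 0 := inv_ne_zero (norm_ne_zero_iff.2 hn0)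
  simp only [map_smul, inner_smul_left, inner_smul_right, conj_trivial] at hle
  rwa [mul_div_mul_left _ _ hnorm, mul_div_mul_left _ _ hnorm,
    div_le_iff₀ (inner_apply_self_pos_of_mem_ker_orthogonal hP hn hn0)] at hle

lemma isPositive_of_inner_nonneg_of_mem_ker_orthogonal {R : T →ₗ[ℝ] T} (hR : R.IsSymmetric)
    (hker : P.ker ≤ R.ker) (h : ∀ n ∈ P.kerᗮ, 0 ≤ ⟪R n, n⟫) : R.IsPositive := by
  refine (LinearMap.isPositive_iff _).2 ⟨hR, fun x => ?_⟩
  obtain ⟨y, hy, z, hz, rfl⟩ := P.ker.exists_add_mem_mem_orthogonal x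
  have hRy : R y = 0 := hker hy
  have hRzy : ⟪R z, y⟫ = 0 := by rw [hR, hRy, inner_zero_right]
  rw [map_add, hRy, zero_add, inner_add_right, hRzy, zero_add]
  exact h z hz

lemma exists_apply_eq_smul_add_apply (hP : P.IsPositive) (hQ : Q.IsPositive) (hPQ : P + Q ≠ 0) :
    ∃ m : T, (P + Q) m ≠ 0 ∧ ∃ a b : ℝ, 0 ≤ a ∧ 0 ≤ b ∧ a + b = 1 ∧
      P m = a • (P + Q) m ∧ Q m = b • (P + Q) m := by
  have hS : (P + Q).IsPositive := hP.add hQ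
  have hker : (P + Q).ker ≤ Q.ker := fun x hx => by
    have hsum : ⟪P x, x⟫ + ⟪Q x, x⟫ = 0 := by
      rw [← inner_add_left, ← LinearMap.add_apply, LinearMap.mem_ker.1 hx, inner_zero_left]
    exact apply_eq_zero_of_inner_apply_self_eq_zero hQ
      ((add_eq_zero_iff_of_nonneg (hP.inner_nonneg_left x) (hQ.inner_nonneg_left x)).1 hsum).2
  obtain ⟨m, hm, hm0, hmax⟩ := exists_forall_inner_apply_le hS hPQ Q
  have hSm : 0 < ⟪(P + Q) m, m⟫ := inner_apply_self_pos_of_mem_ker_orthogonal hS hm hm0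
  set b := ⟪Q m, m⟫ / ⟪(P + Q) m, m⟫
  have hR : (b • (P + Q) - Q).IsPositive := by
    refine isPositive_of_inner_nonneg_of_mem_ker_orthogonal (P := P + Q)
      (((hS.isSymmetric.smul (conj_trivial b)).sub hQ.isSymmetric)) (fun x hx => ?_) fun n hn => ?_
    · rw [LinearMap.mem_ker, LinearMap.sub_apply, LinearMap.smul_apply, LinearMap.mem_ker.1 hx,
        hker hx, smul_zero, sub_zero]
    · rw [LinearMap.sub_apply, LinearMap.smul_apply, inner_sub_left, real_inner_smul_left]
      exact sub_nonneg.2 (hmax n hn)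
  have hQm : Q m = b • (P + Q) m := by
    refine (sub_eq_zero.1 (apply_eq_zero_of_inner_apply_self_eq_zero hR ?_)).symm
    rw [LinearMap.sub_apply, LinearMap.smul_apply, inner_sub_left, real_inner_smul_left,
      div_mul_cancel₀ _ hSm.ne', sub_self]
  have hPm : P m = (1 - b) • (P + Q) m := by
    rw [sub_smul, one_smul, ← hQm, LinearMap.add_apply, add_sub_cancel_right]
  refine ⟨m, fun h => hSm.ne' (by rw [h, inner_zero_left]), 1 - b, b, sub_nonneg.2 ?_,
    div_nonneg (hQ.inner_nonneg_left m) hSm.le, sub_add_cancel 1 b, hPm, hQm⟩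
  rw [div_le_one hSm, LinearMap.add_apply, inner_add_left]
  exact le_add_of_nonneg_left (hP.inner_nonneg_left m)

end PositivePencils

section TamePairs

open InnerProductSpace

variable {T : Type*} [NormedAddCommGroup T] [InnerProductSpace ℝ T]

lemma tame_of_forall_norm_eq_one {B : T →ₗ[ℝ] T →ₗ[ℝ] ℝ} {K : T →L[ℝ] T}
    (h : ∀ v, ‖v‖ = 1 → 0 < B v (K v)) {v : T} (hv : v ≠ 0) : 0 < B v (K v) := by
  have hpos := h _ (norm_smul_inv_norm (𝕜 := ℝ) hv)
  simp only [map_smul, LinearMap.smul_apply, smul_eq_mul, ← mul_assoc] at hpos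
  exact pos_of_mul_pos_right hpos (mul_self_nonneg _)

/-- The functionals `K ↦ tr (P ∘ B₀ ∘ K) + tr (Q ∘ B₁ ∘ K)` for positive operators `P` and `Q` of
total trace `1`, where `B₀` and `B₁` stand for their matrices. They are encoded by their values on
operators of rank one. -/
def traceFunctionals (B₀ B₁ : T →ₗ[ℝ] T →ₗ[ℝ] ℝ) : Set ((T →L[ℝ] T) →L[ℝ] ℝ) :=
  {ψ | ∃ P Q : T →ₗ[ℝ] T, P.IsPositive ∧ Q.IsPositive ∧ P.trace ℝ T + Q.trace ℝ T = 1 ∧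
    ∀ m x, ψ (rankOne ℝ x m) = B₀ (P m) x + B₁ (Q m) x}

lemma convex_traceFunctionals (B₀ B₁ : T →ₗ[ℝ] T →ₗ[ℝ] ℝ) :
    Convex ℝ (traceFunctionals B₀ B₁) := by
  rintro ψ ⟨P, Q, hP, hQ, hPQ, hψ⟩ ψ' ⟨P', Q', hP', hQ', hPQ', hψ'⟩ c d hc hd hcd
  refine ⟨c • P + d • P', c • Q + d • Q', (hP.smul_of_nonneg hc).add (hP'.smul_of_nonneg hd),
    (hQ.smul_of_nonneg hc).add (hQ'.smul_of_nonneg hd), ?_, fun m x => ?_⟩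
  · simp only [map_add, map_smul, smul_eq_mul]
    linear_combination c * hPQ + d * hPQ' + hcd
  · simp only [_root_.add_apply, _root_.smul_apply, hψ, hψ', LinearMap.add_apply,
      LinearMap.smul_apply, map_add, map_smul, smul_eq_mul]
    ring

variable {B₀ B₁ : T →ₗ[ℝ] T →ₗ[ℝ] ℝ}

lemma traceFunctionals_comm : traceFunctionals B₀ B₁ = traceFunctionals B₁ B₀ := by
  refine Subset.antisymm ?_ ?_ <;> rintro ψ ⟨P, Q, hP, hQ, hPQ, hψ⟩ <;>
    exact ⟨Q, P, hQ, hP, by rwa [add_comm], fun m x => by rw [hψ, add_comm]⟩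

variable [FiniteDimensional ℝ T]

/-- The functional `K ↦ B (v, K v)` on endomorphisms, whose positivity for all `v ≠ 0` says that
`B` tames `K`. -/
def tameFunctional (B : T →ₗ[ℝ] T →ₗ[ℝ] ℝ) (v : T) : (T →L[ℝ] T) →L[ℝ] ℝ :=
  (LinearMap.toContinuousLinearMap (B v)).comp (ContinuousLinearMap.apply ℝ T v)

lemma tameFunctional_apply (B : T →ₗ[ℝ] T →ₗ[ℝ] ℝ) (v : T) (K : T →L[ℝ] T) :
    tameFunctional B v K = B v (K v) := rfl

lemma tameFunctional_rankOne (B : T →ₗ[ℝ] T →ₗ[ℝ] ℝ) (v m x : T) :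
    tameFunctional B v (rankOne ℝ x m) = B (rankOne ℝ v v m) x := by
  simp only [tameFunctional_apply, rankOne_apply, map_smul, LinearMap.smul_apply,
    real_inner_comm m v]

lemma continuous_tameFunctional (B : T →ₗ[ℝ] T →ₗ[ℝ] ℝ) : Continuous (tameFunctional B) := by
  have hB : Continuous fun v => LinearMap.toContinuousLinearMap (B v) :=
    (LinearMap.toContinuousLinearMap.toLinearMap ∘ₗ B).continuous_of_finiteDimensional
  exact hB.clm_comp (ContinuousLinearMap.apply ℝ T).continuous

lemma tameFunctional_mem_traceFunctionals_left {v : T} (hv : ‖v‖ = 1) :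
    tameFunctional B₀ v ∈ traceFunctionals B₀ B₁ := by
  refine ⟨(rankOne ℝ v v).toLinearMap, 0, (isPositive_rankOne_self v).toLinearMap,
    LinearMap.isPositive_zero, ?_, fun m x => ?_⟩
  · rw [trace_rankOne, map_zero, add_zero, real_inner_self_eq_norm_sq, hv, one_pow]
  · rw [tameFunctional_rankOne, LinearMap.zero_apply, map_zero, LinearMap.zero_apply, add_zero,
      ContinuousLinearMap.coe_coe]

lemma zero_notMem_traceFunctionals (h : ∀ B ∈ segment ℝ B₀ B₁, B.SeparatingLeft) :
    0 ∉ traceFunctionals B₀ B₁ := by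
  rintro ⟨P, Q, hP, hQ, hPQ, h0⟩
  have hne : P + Q ≠ 0 := fun hzero => by
    rw [← map_add, hzero, map_zero] at hPQ
    exact zero_ne_one hPQ
  obtain ⟨m, hm, a, b, ha, hb, hab, hPm, hQm⟩ := exists_apply_eq_smul_add_apply hP hQ hne
  refine hm (h _ ⟨a, b, ha, hb, hab, rfl⟩ _ fun x => ?_)
  calc (a • B₀ + b • B₁) ((P + Q) m) x = B₀ (P m) x + B₁ (Q m) x := by
        rw [hPm, hQm]
        simp only [LinearMap.add_apply, LinearMap.smul_apply, map_smul]
    _ = 0 := (h0 m x).symm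

theorem exists_tame_pair (h : ∀ B ∈ segment ℝ B₀ B₁, B.SeparatingLeft) :
    ∃ K : T →L[ℝ] T, (∀ v, v ≠ 0 → 0 < B₀ v (K v)) ∧ ∀ v, v ≠ 0 → 0 < B₁ v (K v) := by
  let D : Set ((T →L[ℝ] T) →L[ℝ] ℝ) :=
    tameFunctional B₀ '' Metric.sphere 0 1 ∪ tameFunctional B₁ '' Metric.sphere 0 1
  have hcompact : IsCompact D :=
    ((isCompact_sphere 0 1).image (continuous_tameFunctional B₀)).union
      ((isCompact_sphere 0 1).image (continuous_tameFunctional B₁))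
  have hD : D ⊆ traceFunctionals B₀ B₁ := by
    rintro ψ (⟨v, hv, rfl⟩ | ⟨v, hv, rfl⟩)
    · exact tameFunctional_mem_traceFunctionals_left (mem_sphere_zero_iff_norm.1 hv)
    · rw [traceFunctionals_comm]
      exact tameFunctional_mem_traceFunctionals_left (mem_sphere_zero_iff_norm.1 hv)
  obtain ⟨K, hK⟩ := exists_forall_pos_of_zero_notMem_convexHull hcompact fun h0 =>
    zero_notMem_traceFunctionals h (convexHull_min hD (convex_traceFunctionals B₀ B₁) h0)
  exact ⟨K, fun v => tame_of_forall_norm_eq_one fun w hw =>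
      hK _ (Or.inl (mem_image_of_mem _ (mem_sphere_zero_iff_norm.2 hw))),
    fun v => tame_of_forall_norm_eq_one fun w hw =>
      hK _ (Or.inr (mem_image_of_mem _ (mem_sphere_zero_iff_norm.2 hw)))⟩

end TamePairs

section TameGluing

variable {T : Type*} [AddCommGroup T] [Module ℝ T] {B : LinearMap.BilinForm ℝ T}
  {S S' : Submodule ℝ T}

lemma tame_of_codisjoint (hS : Codisjoint S S') (hB : ∀ v ∈ S, ∀ w ∈ S', B v w = 0)
    (hB' : ∀ v ∈ S', ∀ w ∈ S, B v w = 0) {K : T →ₗ[ℝ] T} (hKS : ∀ v ∈ S, K v ∈ S)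
    (hKS' : ∀ v ∈ S', K v ∈ S') (hK : ∀ v ∈ S, v ≠ 0 → 0 < B v (K v))
    (hK' : ∀ v ∈ S', v ≠ 0 → 0 < B v (K v)) {v : T} (hv : v ≠ 0) : 0 < B v (K v) := by
  have nonneg {S : Submodule ℝ T} (hK : ∀ v ∈ S, v ≠ 0 → 0 < B v (K v)) :
      ∀ v ∈ S, 0 ≤ B v (K v) := fun v hv => by
    obtain rfl | hv0 := eq_or_ne v 0
    · rw [map_zero, LinearMap.zero_apply]
    · exact (hK v hv hv0).le
  obtain ⟨y, z, hy, hz, rfl⟩ := Submodule.codisjoint_iff_exists_add_eq.1 hS v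
  have hsum : B (y + z) (K (y + z)) = B y (K y) + B z (K z) := by
    simp only [map_add, LinearMap.add_apply, hB y hy _ (hKS' z hz), hB' z hz _ (hKS y hy)]
    ring
  rw [hsum]
  obtain rfl | hy0 := eq_or_ne y 0
  · have hz0 : z ≠ 0 := by rwa [zero_add] at hv
    exact add_pos_of_nonneg_of_pos (nonneg hK _ hy) (hK' z hz hz0)
  · exact add_pos_of_pos_of_nonneg (hK y hy hy0) (nonneg hK' z hz)

lemma isCompl_orthogonal_of_separatingLeft [FiniteDimensional ℝ T] (hB : B.IsAlt)
    (hS : (B.restrict S).SeparatingLeft) : IsCompl S (B.orthogonal S) :=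
  LinearMap.BilinForm.isCompl_orthogonal_of_restrict_nondegenerate hB.isRefl <|
    (hB.isRefl.domRestrict S).nondegenerate_iff_separatingLeft.2 hS

lemma separatingLeft_restrict_orthogonal [FiniteDimensional ℝ T] (hB : B.IsAlt)
    (hnd : B.SeparatingLeft) (hS : (B.restrict S).SeparatingLeft) :
    (B.restrict (B.orthogonal S)).SeparatingLeft := by
  refine ((LinearMap.BilinForm.restrict_nondegenerate_iff_isCompl_orthogonal hB.isRefl).2 ?_).1
  rw [LinearMap.BilinForm.orthogonal_orthogonal
    (hB.isRefl.nondegenerate_iff_separatingLeft.2 hnd) hB.isRefl]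
  exact (isCompl_orthogonal_of_separatingLeft hB hS).symm

end TameGluing

theorem exists_tame_preserving {T : Type*} [NormedAddCommGroup T] [InnerProductSpace ℝ T]
    [FiniteDimensional ℝ T] {B B₁ : LinearMap.BilinForm ℝ T} (hB : B.IsAlt)
    (hnd : B.SeparatingLeft) (S : Submodule ℝ T)
    (h : ∀ b ∈ segment ℝ (B.restrict S) (B₁.restrict S), b.SeparatingLeft) :
    ∃ K : T →L[ℝ] T, (∀ v, v ≠ 0 → 0 < B v (K v)) ∧ (∀ v ∈ S, K v ∈ S) ∧
      ∀ v ∈ S, v ≠ 0 → 0 < B₁ v (K v) := by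
  let S' : Submodule ℝ T := B.orthogonal S
  have hBS : (B.restrict S).SeparatingLeft := h _ (left_mem_segment ℝ _ _)
  have hcompl : IsCompl S S' := isCompl_orthogonal_of_separatingLeft hB hBS
  obtain ⟨K₁, hK₁, hK₁'⟩ := exists_tame_pair h
  obtain ⟨K₂, hK₂, -⟩ := exists_tame_pair (B₀ := B.restrict S') (B₁ := B.restrict S')
    fun b hb => by
      rw [segment_same, mem_singleton_iff] at hb
      exact hb ▸ separatingLeft_restrict_orthogonal hB hnd hBS
  let K : T →ₗ[ℝ] T :=
    LinearMap.ofIsCompl hcompl (S.subtype ∘ₗ K₁.toLinearMap) (S'.subtype ∘ₗ K₂.toLinearMap)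
  have hKS : ∀ v (hv : v ∈ S), K v = K₁ ⟨v, hv⟩ := fun v hv =>
    LinearMap.ofIsCompl_apply_left hcompl ⟨v, hv⟩
  have hKS' : ∀ v (hv : v ∈ S'), K v = K₂ ⟨v, hv⟩ := fun v hv =>
    LinearMap.ofIsCompl_apply_right hcompl ⟨v, hv⟩
  have hmem : ∀ v ∈ S, K v ∈ S := fun v hv => hKS v hv ▸ (K₁ ⟨v, hv⟩).2
  refine ⟨LinearMap.toContinuousLinearMap K, fun v hv => ?_, hmem, fun v hv hv0 => ?_⟩
  · refine tame_of_codisjoint (K := K) hcompl.codisjoint (fun v hv w hw => hw v hv)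
      (fun v hv w hw => hB.isRefl w v (hv w hw)) hmem (fun v hv => hKS' v hv ▸ (K₂ ⟨v, hv⟩).2)
      (fun v hv hv0 => ?_) (fun v hv hv0 => ?_) hv
    · rw [hKS v hv]
      exact hK₁ ⟨v, hv⟩ (Subtype.coe_ne_coe.1 hv0)
    · rw [hKS' v hv]
      exact hK₂ ⟨v, hv⟩ (Subtype.coe_ne_coe.1 hv0)
  · rw [LinearMap.coe_toContinuousLinearMap', hKS v hv]
    exact hK₁' ⟨v, hv⟩ (Subtype.coe_ne_coe.1 hv0)

section PairVolume

variable {T : Type*} [AddCommGroup T] [Module ℝ T] {ι : Type*}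

lemma exists_eq_prodCongrLeft_mul_prodCongrRight [Finite ι] {κ : Type*} [Finite κ] [Nonempty κ]
    {σ : Equiv.Perm (ι × κ)} (hσ : ∀ i ε δ, (σ (i, ε)).1 = (σ (i, δ)).1) :
    ∃ (τ : Equiv.Perm ι) (f : ι → Equiv.Perm κ),
      σ = (Equiv.prodCongrLeft fun _ => τ) * Equiv.prodCongrRight f := by
  have hinj : ∀ i, Function.Injective fun ε => (σ (i, ε)).2 := fun i ε δ h =>
    congrArg Prod.snd (σ.injective (Prod.ext (hσ i ε δ) h))
  let f : ι → Equiv.Perm κ := fun i =>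
    Equiv.ofBijective _ (Finite.injective_iff_bijective.1 (hinj i))
  let ε₀ : κ := Classical.arbitrary κ
  have hτ : Function.Injective fun i => (σ (i, ε₀)).1 := fun i j h => by
    obtain ⟨ε, hε⟩ := (f j).surjective (σ (i, ε₀)).2
    exact congrArg Prod.fst (σ.injective (Prod.ext (h.trans (hσ j ε₀ ε)) hε.symm))
  refine ⟨Equiv.ofBijective _ (Finite.injective_iff_bijective.1 hτ), f, ?_⟩
  ext ⟨i, ε⟩
  · exact hσ i ε ε₀
  · rfl

/-- The entries of a symplectic form in a symplectic basis, whose elements are labelled so that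
`(i, 0)` and `(i, 1)` are conjugate. -/
def stdSymp [DecidableEq ι] (a b : ι × Fin 2) : ℤ :=
  if a.1 = b.1 then !![0, 1; -1, 0] a.2 b.2 else 0

variable [Fintype ι] [DecidableEq ι]

lemma sign_mul_prod_stdSymp_nonneg (σ : Equiv.Perm (ι × Fin 2)) :
    0 ≤ (Equiv.Perm.sign σ : ℤ) * ∏ i : ι, stdSymp (σ (i, 0)) (σ (i, 1)) := by
  by_cases hσ : ∀ i, (σ (i, 0)).1 = (σ (i, 1)).1
  · obtain ⟨τ, f, rfl⟩ := exists_eq_prodCongrLeft_mul_prodCongrRight (σ := σ) fun i => by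
      simp only [Fin.forall_fin_two, hσ i, and_self]
    have hsign : ∀ g : Equiv.Perm (Fin 2),
        (!![0, 1; -1, 0] : Matrix (Fin 2) (Fin 2) ℤ) (g 0) (g 1) = Equiv.Perm.sign g := by decide
    rw [Equiv.Perm.sign_mul, Equiv.Perm.sign_prodCongrLeft, Equiv.Perm.sign_prodCongrRight]
    simp only [stdSymp, Equiv.Perm.mul_apply, Equiv.prodCongrLeft_apply,
      Equiv.prodCongrRight_apply, hsign, if_true, Finset.prod_const, Finset.card_univ,
      Fintype.card_fin, Int.units_sq, one_mul, Units.coe_prod]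
    exact mul_self_nonneg _
  · push Not at hσ
    obtain ⟨i, hi⟩ := hσ
    rw [Finset.prod_eq_zero (Finset.mem_univ i) (if_neg hi), mul_zero]

lemma prod_apply_update (β : T →ₗ[ℝ] T →ₗ[ℝ] ℝ) (e : ι × Fin 2 → T) (a : ι × Fin 2) (z : T) :
    ∏ i, β (Function.update e a z (i, 0)) (Function.update e a z (i, 1)) =
      β (Function.update e a z (a.1, 0)) (Function.update e a z (a.1, 1)) *
        ∏ i ∈ Finset.univ.erase a.1, β (e (i, 0)) (e (i, 1)) := by
  rw [← Finset.mul_prod_erase _ _ (Finset.mem_univ a.1)]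
  congr 1
  refine Finset.prod_congr rfl fun i hi => ?_
  have hne : ∀ ε, (i, ε) ≠ a := fun ε h => Finset.ne_of_mem_erase hi (congrArg Prod.fst h)
  rw [Function.update_of_ne (hne 0), Function.update_of_ne (hne 1)]

/-- The multilinear map `∏ i, β (e (i, 0)) (e (i, 1))`, whose antisymmetrization is the volume of
frames. -/
def pairProd (β : T →ₗ[ℝ] T →ₗ[ℝ] ℝ) : MultilinearMap ℝ (fun _ : ι × Fin 2 => T) ℝ where
  toFun e := ∏ i, β (e (i, 0)) (e (i, 1))
  map_update_add' {inst} e a x y := by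
    obtain rfl : inst = instDecidableEqProd := Subsingleton.elim _ _
    rw [prod_apply_update, prod_apply_update, prod_apply_update, ← add_mul]
    obtain ⟨i, ε⟩ := a
    fin_cases ε <;> simp
  map_update_smul' {inst} e a c x := by
    obtain rfl : inst = instDecidableEqProd := Subsingleton.elim _ _
    rw [prod_apply_update, prod_apply_update, smul_eq_mul, ← mul_assoc]
    obtain ⟨i, ε⟩ := a
    fin_cases ε <;> simp

/-- A positive multiple of the top exterior power of `β`, on frames indexed by pairs. -/
def pairVolume (β : T →ₗ[ℝ] T →ₗ[ℝ] ℝ) : T [⋀^ι × Fin 2]→ₗ[ℝ] ℝ :=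
  MultilinearMap.alternatization (pairProd β)

lemma pairVolume_apply (β : T →ₗ[ℝ] T →ₗ[ℝ] ℝ) (e : ι × Fin 2 → T) :
    pairVolume β e = ∑ σ : Equiv.Perm (ι × Fin 2), ((Equiv.Perm.sign σ : ℤ) : ℝ) *
      ∏ i, β (e (σ (i, 0))) (e (σ (i, 1))) := by
  rw [pairVolume, MultilinearMap.alternatization_apply]
  refine Finset.sum_congr rfl fun σ _ => ?_
  rw [Units.smul_def, zsmul_eq_mul]
  rfl

lemma pairVolume_pos_of_eq_stdSymp {β : T →ₗ[ℝ] T →ₗ[ℝ] ℝ} {e : ι × Fin 2 → T}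
    (h : ∀ a b, β (e a) (e b) = stdSymp a b) : 0 < pairVolume β e := by
  simp only [pairVolume_apply, h]
  refine Finset.sum_pos' (fun σ _ => mod_cast sign_mul_prod_stdSymp_nonneg σ)
    ⟨1, Finset.mem_univ _, ?_⟩
  simp [stdSymp]

end PairVolume

section SymplecticBases

variable {T : Type*} [AddCommGroup T] [Module ℝ T] {β : LinearMap.BilinForm ℝ T}

lemma exists_apply_eq_one_of_separatingLeft [Nontrivial T] (hnd : β.SeparatingLeft) :
    ∃ v w, β v w = 1 := by
  obtain ⟨v, hv⟩ := exists_ne (0 : T)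
  obtain ⟨w, hw⟩ := not_forall.1 fun h => hv (hnd v h)
  exact ⟨v, (β v w)⁻¹ • w, by rw [map_smul, smul_eq_mul, inv_mul_cancel₀ hw]⟩

lemma apply_smul_add_smul (hβ : β.IsAlt) {v w : T} (hvw : β v w = 1) (a b : ℝ) :
    β v (a • v + b • w) = b ∧ β w (a • v + b • w) = -a := by
  have hwv : β w v = -1 := by rw [← hvw, LinearMap.IsAlt.neg hβ]
  simp [hβ.self_eq_zero, hvw, hwv]

lemma separatingLeft_restrict_span_pair (hβ : β.IsAlt) {v w : T} (hvw : β v w = 1) :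
    (β.restrict (Submodule.span ℝ {v, w})).SeparatingLeft := by
  rintro ⟨u, hu⟩ h
  obtain ⟨a, b, rfl⟩ := Submodule.mem_span_pair.1 hu
  have hv : β v (a • v + b • w) = 0 :=
    hβ.isRefl _ _ (h ⟨v, Submodule.mem_span_of_mem (mem_insert v {w})⟩)
  have hw : β w (a • v + b • w) = 0 :=
    hβ.isRefl _ _ (h ⟨w, Submodule.mem_span_of_mem (mem_insert_of_mem v rfl)⟩)
  rw [(apply_smul_add_smul hβ hvw a b).1] at hv
  rw [(apply_smul_add_smul hβ hvw a b).2, neg_eq_zero] at hw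
  simp [hv, hw]

lemma finrank_span_pair_of_apply_eq_one (hβ : β.IsAlt) {v w : T} (hvw : β v w = 1) :
    finrank ℝ (Submodule.span ℝ {v, w}) = 2 := by
  have hli : LinearIndependent ℝ ![v, w] := LinearIndependent.pair_iff.2 fun a b hab => by
    have h := apply_smul_add_smul hβ hvw a b
    rw [hab, map_zero, map_zero] at h
    exact ⟨neg_eq_zero.1 h.2.symm, h.1.symm⟩
  rw [← Matrix.range_cons_cons_empty v w ![]]
  exact finrank_span_eq_card hli

lemma cons_eq_stdSymp (hβ : β.IsAlt) {v w : T} (hvw : β v w = 1) {n : ℕ} {e : Fin n × Fin 2 → T}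
    (he : ∀ a b, β (e a) (e b) = stdSymp a b) (hv : ∀ a, β v (e a) = 0) (hw : ∀ a, β w (e a) = 0)
    (a b : Fin (n + 1) × Fin 2) :
    β (Fin.cases (![v, w] a.2) (fun i => e (i, a.2)) a.1)
      (Fin.cases (![v, w] b.2) (fun i => e (i, b.2)) b.1) = stdSymp a b := by
  have hwv : β w v = -1 := by rw [← hvw, LinearMap.IsAlt.neg hβ]
  have hev : ∀ a, β (e a) v = 0 := fun a => hβ.isRefl _ _ (hv a)
  have hew : ∀ a, β (e a) w = 0 := fun a => hβ.isRefl _ _ (hw a)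
  obtain ⟨i, ε⟩ := a
  obtain ⟨j, δ⟩ := b
  cases i using Fin.cases <;> cases j using Fin.cases
  · fin_cases ε <;> fin_cases δ <;> simp [stdSymp, hβ.self_eq_zero, hvw, hwv]
  · fin_cases ε <;> simp [stdSymp, hv, hw, (Fin.succ_ne_zero _).symm]
  · fin_cases δ <;> simp [stdSymp, hev, hew, Fin.succ_ne_zero]
  · simp [stdSymp, he]

lemma exists_symplectic_family (n : ℕ) {T : Type*} [AddCommGroup T] [Module ℝ T]
    [FiniteDimensional ℝ T] (hT : finrank ℝ T = 2 * n) {β : LinearMap.BilinForm ℝ T}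
    (hβ : β.IsAlt) (hnd : β.SeparatingLeft) :
    ∃ e : Fin n × Fin 2 → T, ∀ a b, β (e a) (e b) = stdSymp a b := by
  induction n generalizing T with
  | zero => exact ⟨fun a => a.1.elim0, fun a => a.1.elim0⟩
  | succ n ih =>
    have : Nontrivial T := Module.nontrivial_of_finrank_pos (R := ℝ) (by omega)
    obtain ⟨v, w, hvw⟩ := exists_apply_eq_one_of_separatingLeft hnd
    have hS := separatingLeft_restrict_span_pair hβ hvw
    have hcompl := isCompl_orthogonal_of_separatingLeft hβ hS
    have hdim : finrank ℝ (β.orthogonal (Submodule.span ℝ {v, w})) = 2 * n := by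
      have hadd := Submodule.finrank_add_eq_of_isCompl hcompl
      rw [finrank_span_pair_of_apply_eq_one hβ hvw] at hadd
      omega
    obtain ⟨e, he⟩ := ih hdim (fun x => hβ x) (separatingLeft_restrict_orthogonal hβ hnd hS)
    exact ⟨_, cons_eq_stdSymp hβ hvw (e := fun a => e a) he
      (fun a => (e a).2 v (Submodule.mem_span_of_mem (mem_insert v {w})))
      (fun a => (e a).2 w (Submodule.mem_span_of_mem (mem_insert_of_mem v rfl)))⟩

end SymplecticBases

section Orientation

variable {T : Type*} [AddCommGroup T] [Module ℝ T]

section StdSympForm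

lemma repr_complex_apply {ι : Type*} {b : Basis (ι × Fin 2) ℝ T} {J : T →ₗ[ℝ] T}
    (hJ : ∀ v, J (J v) = -v) (hb : ∀ i, b (i, 1) = J (b (i, 0))) (v : T) (i : ι) :
    b.repr (J v) (i, 0) = -b.repr v (i, 1) ∧ b.repr (J v) (i, 1) = b.repr v (i, 0) := by
  classical
  have hb' : ∀ i, J (b (i, 1)) = -b (i, 0) := fun i => by rw [hb, hJ]
  have h₀ : b.coord (i, 0) ∘ₗ J = -b.coord (i, 1) := b.ext fun ⟨j, δ⟩ => by
    fin_cases δ <;> simp [← hb, hb', Finsupp.single_apply]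
  have h₁ : b.coord (i, 1) ∘ₗ J = b.coord (i, 0) := b.ext fun ⟨j, δ⟩ => by
    fin_cases δ <;> simp [← hb, hb', Finsupp.single_apply]
  exact ⟨LinearMap.congr_fun h₀ v, LinearMap.congr_fun h₁ v⟩

variable {ι : Type*} [Fintype ι] (b : Basis (ι × Fin 2) ℝ T)

/-- The symplectic form with symplectic basis `b`. -/
def stdSympForm : LinearMap.BilinForm ℝ T :=
  ∑ i, ((b.coord (i, 0)).smulRight (b.coord (i, 1)) - (b.coord (i, 1)).smulRight (b.coord (i, 0)))

lemma stdSympForm_apply (v w : T) : stdSympForm b v w =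
    ∑ i, (b.repr v (i, 0) * b.repr w (i, 1) - b.repr v (i, 1) * b.repr w (i, 0)) := by
  simp [stdSympForm, LinearMap.sum_apply]

lemma isAlt_stdSympForm : (stdSympForm b).IsAlt := fun v => by
  rw [stdSympForm_apply]
  exact Finset.sum_eq_zero fun i _ => by ring

lemma stdSympForm_basis [DecidableEq ι] (x y : ι × Fin 2) :
    stdSympForm b (b x) (b y) = stdSymp x y := by
  obtain ⟨i, ε⟩ := x
  obtain ⟨j, δ⟩ := y
  simp only [stdSympForm_apply, Basis.repr_self, Finsupp.single_apply, Prod.mk.injEq]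
  rw [Finset.sum_eq_single i (fun l _ hl => by simp [hl.symm]) (by simp)]
  obtain rfl | hij := eq_or_ne i j
  · fin_cases ε <;> fin_cases δ <;> simp [stdSymp]
  · simp [stdSymp, hij, hij.symm]

variable {b} {J : T →ₗ[ℝ] T}

lemma stdSympForm_apply_complex (hJ : ∀ v, J (J v) = -v) (hb : ∀ i, b (i, 1) = J (b (i, 0)))
    (v : T) : stdSympForm b v (J v) = ∑ x, b.repr v x ^ 2 := by
  rw [stdSympForm_apply, Fintype.sum_prod_type]
  refine Finset.sum_congr rfl fun i _ => ?_
  rw [(repr_complex_apply hJ hb v i).1, (repr_complex_apply hJ hb v i).2, Fin.sum_univ_two]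
  ring

lemma stdSympForm_apply_complex_pos (hJ : ∀ v, J (J v) = -v)
    (hb : ∀ i, b (i, 1) = J (b (i, 0))) (v : T) (hv : v ≠ 0) : 0 < stdSympForm b v (J v) := by
  rw [stdSympForm_apply_complex hJ hb]
  obtain ⟨x, hx⟩ := Finsupp.ne_iff.1 ((map_ne_zero_iff b.repr b.repr.injective).2 hv)
  exact Finset.sum_pos' (fun x _ => sq_nonneg _) ⟨x, Finset.mem_univ x, sq_pos_iff.2 hx⟩

end StdSympForm

section Tame

variable {β γ : LinearMap.BilinForm ℝ T} {J : T →ₗ[ℝ] T}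

lemma separatingLeft_of_tame (h : ∀ v, v ≠ 0 → 0 < β v (J v)) : β.SeparatingLeft := fun v hv => by
  by_contra hv0
  exact (h v hv0).ne' (hv (J v))

lemma separatingLeft_of_mem_segment_of_tame (hβ : ∀ v, v ≠ 0 → 0 < β v (J v))
    (hγ : ∀ v, v ≠ 0 → 0 < γ v (J v)) : ∀ b ∈ segment ℝ β γ, b.SeparatingLeft := by
  rintro _ ⟨s, t, hs, ht, hst, rfl⟩
  exact separatingLeft_of_tame (J := J) fun v hv =>
    convex_Ioi (0 : ℝ) (hβ v hv) (hγ v hv) hs ht hst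

end Tame

section Volume

variable {n : ℕ} {β γ : LinearMap.BilinForm ℝ T} (b : Basis (Fin n × Fin 2) ℝ T)

lemma pairVolume_ne_zero (hβ : β.IsAlt) (hnd : β.SeparatingLeft) : pairVolume β b ≠ 0 := by
  have : FiniteDimensional ℝ T := b.finiteDimensional_of_finite
  have hT : finrank ℝ T = 2 * n := by
    rw [finrank_eq_card_basis b, Fintype.card_prod, Fintype.card_fin, Fintype.card_fin, mul_comm]
  obtain ⟨e, he⟩ := exists_symplectic_family n hT hβ hnd
  intro h
  have hpos := pairVolume_pos_of_eq_stdSymp he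
  rw [(pairVolume β).eq_smul_basis_det b, h, zero_smul] at hpos
  exact hpos.false

lemma pairVolume_pos_of_segment (hβ : β.IsAlt) (hγ : γ.IsAlt)
    (hnd : ∀ b ∈ segment ℝ β γ, b.SeparatingLeft) (hpos : 0 < pairVolume γ b) :
    0 < pairVolume β b := by
  let F : ℝ → ℝ := fun t => pairVolume ((1 - t) • β + t • γ) b
  have hF : Continuous F := by
    simp only [F, pairVolume_apply, LinearMap.add_apply, LinearMap.smul_apply]
    fun_prop
  have hF₀ : F 0 = pairVolume β b := by simp only [F, sub_zero, one_smul, zero_smul, add_zero]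
  have hF₁ : F 1 = pairVolume γ b := by simp only [F, sub_self, one_smul, zero_smul, zero_add]
  by_contra hneg
  obtain ⟨t, ht, hFt⟩ := intermediate_value_Icc (zero_le_one (α := ℝ)) hF.continuousOn
    ⟨hF₀.trans_le (not_lt.1 hneg), hF₁ ▸ hpos.le⟩
  refine pairVolume_ne_zero b (fun v => ?_)
    (hnd _ ⟨1 - t, t, sub_nonneg.2 ht.2, ht.1, sub_add_cancel 1 t, rfl⟩) hFt
  simp [hβ.self_eq_zero, hγ.self_eq_zero]

variable {b} {J : T →ₗ[ℝ] T}

lemma pairVolume_pos_of_tame (hβ : β.IsAlt) (hJ : ∀ v, J (J v) = -v)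
    (htame : ∀ v, v ≠ 0 → 0 < β v (J v)) (hb : ∀ i, b (i, 1) = J (b (i, 0))) :
    0 < pairVolume β b :=
  pairVolume_pos_of_segment b hβ (isAlt_stdSympForm b)
    (separatingLeft_of_mem_segment_of_tame htame (stdSympForm_apply_complex_pos hJ hb))
    (pairVolume_pos_of_eq_stdSymp (stdSympForm_basis b))

lemma exists_complex_basis [FiniteDimensional ℝ T] (hJ : ∀ v, J (J v) = -v)
    (hT : finrank ℝ T = 2 * n) :
    ∃ b : Basis (Fin n × Fin 2) ℝ T, ∀ i, b (i, 1) = J (b (i, 0)) := by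
  let φ : ℂ →ₐ[ℝ] Module.End ℝ T := Complex.lift ⟨J, LinearMap.ext hJ⟩
  let _ : Module ℂ T := Module.compHom T φ.toRingHom
  have hsmul : ∀ (z : ℂ) (v : T), z • v = φ z v := fun _ _ => rfl
  have : IsScalarTower ℝ ℂ T := ⟨fun r z v => by rw [hsmul, hsmul, map_smul]; rfl⟩
  have : FiniteDimensional ℂ T := Module.Finite.of_restrictScalars_finite ℝ ℂ T
  have hn : finrank ℂ T = n := by
    have h := Module.finrank_mul_finrank ℝ ℂ T
    rw [Complex.finrank_real_complex, hT] at h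
    omega
  let c : Basis (Fin n) ℂ T := finBasisOfFinrankEq ℂ T hn
  refine ⟨(Complex.basisOneI.smulTower c).reindex (Equiv.prodComm _ _), fun i => ?_⟩
  simp [Basis.smulTower_apply, hsmul, φ]

end Volume

section TwoForms

variable [TopologicalSpace T] (B : T [⋀^Fin 2]→L[ℝ] ℝ)

/-- A continuous alternating 2-form as a bilinear form. -/
def altBilin : LinearMap.BilinForm ℝ T :=
  LinearMap.mk₂ ℝ (fun v w => B ![v, w])
    (fun v v' w => B.vecCons_add ![w] v v')
    (fun c v w => B.vecCons_smul ![w] c v)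
    (fun v w w' => (B.toAlternatingMap.curryLeft v).map_vecCons_add ![] w w')
    (fun c v w => (B.toAlternatingMap.curryLeft v).map_vecCons_smul ![] c w)

lemma altBilin_apply (v w : T) : altBilin B v w = B ![v, w] := rfl

lemma isAlt_altBilin : (altBilin B).IsAlt := fun v =>
  B.map_eq_zero_of_eq ![v, v] (i := 0) (j := 1) rfl Fin.zero_ne_one

/-- The equivalence `(i, ε) ↦ 2 i + ε`. -/
def pairIndex (k : ℕ) : Fin (k + 1) × Fin 2 ≃ Fin (2 * k + 2) :=
  finProdFinEquiv.trans (finCongr (by ring))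

lemma pairIndex_zero (k : ℕ) (i : Fin (k + 1)) :
    pairIndex k (i, 0) = ⟨2 * (i : ℕ), by omega⟩ := by
  ext; simp [pairIndex]

lemma pairIndex_one (k : ℕ) (i : Fin (k + 1)) :
    pairIndex k (i, 1) = ⟨2 * (i : ℕ) + 1, by omega⟩ := by
  ext; simp [pairIndex, add_comm]

lemma symplecticVolume_eq_pairVolume (k : ℕ) (e : Fin (2 * k + 2) → T) :
    symplecticVolume k B e = pairVolume (altBilin B) (e ∘ pairIndex k) := by
  rw [pairVolume_apply, symplecticVolume, ← (pairIndex k).permCongr.sum_comp]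
  refine Finset.sum_congr rfl fun σ _ => ?_
  rw [Equiv.Perm.sign_permCongr]
  congr 1
  refine Finset.prod_congr rfl fun i _ => ?_
  rw [← pairIndex_zero, ← pairIndex_one]
  simp [altBilin_apply]

variable {B} {k : ℕ} {J : T →L[ℝ] T}

lemma symplecticVolume_pos_iff_of_tame (hJ : ∀ v, J (J v) = -v)
    (hB : ∀ v, v ≠ 0 → 0 < B ![v, J v]) {b : Basis (Fin (2 * k + 2)) ℝ T}
    (hb : ∀ i : Fin (k + 1), b ⟨2 * (i : ℕ) + 1, by omega⟩ = J (b ⟨2 * (i : ℕ), by omega⟩))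
    (e : Fin (2 * k + 2) → T) : 0 < symplecticVolume k B e ↔ 0 < b.det e := by
  let b' := b.reindex (pairIndex k).symm
  have hb' : ∀ i, b' (i, 1) = J (b' (i, 0)) := fun i => by
    simp only [b', Basis.reindex_apply, Equiv.symm_symm, pairIndex_zero, pairIndex_one]
    exact hb i
  have hpos := pairVolume_pos_of_tame (isAlt_altBilin B) (J := J.toLinearMap) hJ hB hb'
  have hdet : b'.det (e ∘ pairIndex k) = b.det e := by
    rw [Basis.det_reindex, Function.comp_assoc, Equiv.self_comp_symm, Function.comp_id]
  rw [symplecticVolume_eq_pairVolume, (pairVolume (altBilin B)).eq_smul_basis_det b',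
    AlternatingMap.smul_apply, smul_eq_mul, hdet]
  exact mul_pos_iff_of_pos_left hpos

lemma isComplexPositive_iff_symplecticVolume_pos [FiniteDimensional ℝ T]
    (hT : finrank ℝ T = 2 * k + 2) (hJ : ∀ v, J (J v) = -v)
    (hB : ∀ v, v ≠ 0 → 0 < B ![v, J v]) (e : Fin (2 * k + 2) → T) :
    IsComplexPositive k J e ↔ 0 < symplecticVolume k B e := by
  refine ⟨fun ⟨b, hb, hbe⟩ => (symplecticVolume_pos_iff_of_tame hJ hB hb e).2 hbe, fun h => ?_⟩
  obtain ⟨b, hb⟩ := exists_complex_basis (J := J.toLinearMap) (n := k + 1) hJ (by omega)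
  have hb' : ∀ i : Fin (k + 1), b.reindex (pairIndex k) ⟨2 * (i : ℕ) + 1, by omega⟩ =
      J (b.reindex (pairIndex k) ⟨2 * (i : ℕ), by omega⟩) := fun i => by
    simpa [← pairIndex_zero, ← pairIndex_one] using hb i
  exact ⟨_, hb', (symplecticVolume_pos_iff_of_tame hJ hB hb' e).1 h⟩

end TwoForms

end Orientation

section FormsInCharts

variable {E : Type*} [NormedAddCommGroup E] [NormedSpace ℝ E] {H : Type*} [TopologicalSpace H]
  {I : ModelWithCorners ℝ E H} {M : Type*} [TopologicalSpace M] [ChartedSpace H M] {m : ℕ}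

lemma DForm.apply_congr (Ω : DForm I M m) {x y : M} (h : y = x) (v : Fin m → E) :
    Ω y v = Ω x v := by
  subst h
  rfl

lemma DForm.eq_inChart_comp [IsManifold I 1 M] (Ω : DForm I M m) {x₀ x : M}
    (hx : x ∈ (extChartAt I x₀).source) :
    Ω x = (Ω.inChart x₀ (extChartAt I x₀ x)).compContinuousLinearMap
      (mfderiv I 𝓘(ℝ, E) (extChartAt I x₀) x) := by
  ext v
  have hinv := mfderivWithin_extChartAt_symm_comp_mfderiv_extChartAt' (I := I) hx
  have hv : (fun i => mfderivWithin 𝓘(ℝ, E) I (extChartAt I x₀).symm (range I)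
      (extChartAt I x₀ x) (mfderiv I 𝓘(ℝ, E) (extChartAt I x₀) x (v i))) = v :=
    funext fun i => DFunLike.congr_fun hinv (v i)
  exact ((Ω.apply_congr ((extChartAt I x₀).left_inv hx) _).trans (congrArg (Ω x) hv)).symm

lemma DForm.one_apply_eq_inChart [IsManifold I 1 M] (α : DForm I M 1) {x₀ x : M}
    (hx : x ∈ (extChartAt I x₀).source) (v : TangentSpace I x) :
    α x ![v] = α.inChart x₀ (extChartAt I x₀ x) ![mfderiv I 𝓘(ℝ, E) (extChartAt I x₀) x v] := by
  rw [α.eq_inChart_comp hx]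
  exact congrArg (α.inChart x₀ _) (by ext i; fin_cases i; rfl)

lemma DForm.inChart_one_apply (α : DForm I M 1) (x₀ : M) (y v : E) :
    α.inChart x₀ y ![v] = α ((extChartAt I x₀).symm y)
      ![mfderivWithin 𝓘(ℝ, E) I (extChartAt I x₀).symm (range I) y v] :=
  congrArg (α ((extChartAt I x₀).symm y)) (by ext i; fin_cases i; rfl)

end FormsInCharts

section ExteriorDerivative

variable {E : Type*} [NormedAddCommGroup E] [NormedSpace ℝ E]
  {M : Type*} [TopologicalSpace M] [ChartedSpace E M] {m : ℕ}

lemma DForm.IsSmooth.contDiffAt_inChart {α : DForm 𝓘(ℝ, E) M m} (hα : α.IsSmooth) {x₀ : M} {y : E}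
    (hy : y ∈ (extChartAt 𝓘(ℝ, E) x₀).target) : ContDiffAt ℝ ∞ (α.inChart x₀) y :=
  (hα x₀).contDiffAt ((isOpen_extChartAt_target x₀).mem_nhds hy)

variable [IsManifold 𝓘(ℝ, E) ∞ M] {x₀ x : M}

lemma contDiffAt_transition (hx : x ∈ (extChartAt 𝓘(ℝ, E) x₀).source) :
    ContDiffAt ℝ ∞ (extChartAt 𝓘(ℝ, E) x₀ ∘ (extChartAt 𝓘(ℝ, E) x).symm)
      (extChartAt 𝓘(ℝ, E) x x) := by
  have hsymm : ContMDiffAt 𝓘(ℝ, E) 𝓘(ℝ, E) ∞ (extChartAt 𝓘(ℝ, E) x).symm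
      (extChartAt 𝓘(ℝ, E) x x) :=
    (contMDiffOn_extChartAt_symm x).contMDiffAt (extChartAt_target_mem_nhds x)
  have hchart : ContMDiffAt 𝓘(ℝ, E) 𝓘(ℝ, E) ∞ (extChartAt 𝓘(ℝ, E) x₀)
      ((extChartAt 𝓘(ℝ, E) x).symm (extChartAt 𝓘(ℝ, E) x x)) := by
    rw [extChartAt_to_inv]
    exact contMDiffAt_extChartAt' (extChartAt_source 𝓘(ℝ, E) x₀ ▸ hx)
  exact (hchart.comp _ hsymm).contDiffAt

lemma fderiv_transition_apply {z : E} (hz : z ∈ (extChartAt 𝓘(ℝ, E) x).target)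
    (hz₀ : (extChartAt 𝓘(ℝ, E) x).symm z ∈ (extChartAt 𝓘(ℝ, E) x₀).source) (v : E) :
    fderiv ℝ (extChartAt 𝓘(ℝ, E) x₀ ∘ (extChartAt 𝓘(ℝ, E) x).symm) z v =
      mfderiv 𝓘(ℝ, E) 𝓘(ℝ, E) (extChartAt 𝓘(ℝ, E) x₀) ((extChartAt 𝓘(ℝ, E) x).symm z)
        (mfderivWithin 𝓘(ℝ, E) 𝓘(ℝ, E) (extChartAt 𝓘(ℝ, E) x).symm (range 𝓘(ℝ, E)) z v) := by
  have : IsManifold 𝓘(ℝ, E) 1 M := IsManifold.of_le (n := ∞) (by simp)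
  have hsymm := mdifferentiableWithinAt_extChartAt_symm (I := 𝓘(ℝ, E)) hz
  rw [ModelWithCorners.range_eq_univ, mdifferentiableWithinAt_univ] at hsymm
  have hchart : MDifferentiableAt 𝓘(ℝ, E) 𝓘(ℝ, E) (extChartAt 𝓘(ℝ, E) x₀)
      ((extChartAt 𝓘(ℝ, E) x).symm z) :=
    mdifferentiableAt_extChartAt (extChartAt_source 𝓘(ℝ, E) x₀ ▸ hz₀)
  rw [ModelWithCorners.range_eq_univ, mfderivWithin_univ, ← mfderiv_eq_fderiv]
  exact DFunLike.congr_fun (mfderiv_comp z hchart hsymm) v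

lemma fderiv_transition_comp_mfderiv (hx : x ∈ (extChartAt 𝓘(ℝ, E) x₀).source) :
    (fderiv ℝ (extChartAt 𝓘(ℝ, E) x₀ ∘ (extChartAt 𝓘(ℝ, E) x).symm)
      (extChartAt 𝓘(ℝ, E) x x)).comp (mfderiv 𝓘(ℝ, E) 𝓘(ℝ, E) (extChartAt 𝓘(ℝ, E) x) x) =
      mfderiv 𝓘(ℝ, E) 𝓘(ℝ, E) (extChartAt 𝓘(ℝ, E) x₀) x := by
  have : IsManifold 𝓘(ℝ, E) 1 M := IsManifold.of_le (n := ∞) (by simp)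
  have htrans := ((contDiffAt_transition hx).differentiableAt (by simp)).mdifferentiableAt
  have hchart : MDifferentiableAt 𝓘(ℝ, E) 𝓘(ℝ, E) (extChartAt 𝓘(ℝ, E) x) x :=
    mdifferentiableAt_extChartAt (mem_chart_source E x)
  have heq : (extChartAt 𝓘(ℝ, E) x₀ ∘ (extChartAt 𝓘(ℝ, E) x).symm) ∘ extChartAt 𝓘(ℝ, E) x
      =ᶠ[𝓝 x] extChartAt 𝓘(ℝ, E) x₀ := by
    filter_upwards [extChartAt_source_mem_nhds (I := 𝓘(ℝ, E)) x] with z hz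
    exact congrArg _ ((extChartAt 𝓘(ℝ, E) x).left_inv hz)
  rw [← mfderiv_eq_fderiv, ← heq.mfderiv_eq]
  exact (mfderiv_comp x htrans hchart).symm

lemma DForm.inChart_eventuallyEq_pullback (α : DForm 𝓘(ℝ, E) M m)
    (hx : x ∈ (extChartAt 𝓘(ℝ, E) x₀).source) :
    α.inChart x =ᶠ[𝓝 (extChartAt 𝓘(ℝ, E) x x)] fun z =>
      (α.inChart x₀ ((extChartAt 𝓘(ℝ, E) x₀ ∘ (extChartAt 𝓘(ℝ, E) x).symm) z)
        ).compContinuousLinearMap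
          (fderiv ℝ (extChartAt 𝓘(ℝ, E) x₀ ∘ (extChartAt 𝓘(ℝ, E) x).symm) z) := by
  have : IsManifold 𝓘(ℝ, E) 1 M := IsManifold.of_le (n := ∞) (by simp)
  have hx₀ : (extChartAt 𝓘(ℝ, E) x₀).source ∈
      𝓝 ((extChartAt 𝓘(ℝ, E) x).symm (extChartAt 𝓘(ℝ, E) x x)) := by
    rw [extChartAt_to_inv]
    exact extChartAt_source_mem_nhds' hx
  filter_upwards [extChartAt_target_mem_nhds x, continuousAt_extChartAt_symm x hx₀] with z hz hz₀
  ext v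
  change α ((extChartAt 𝓘(ℝ, E) x).symm z) _ = _
  rw [α.eq_inChart_comp hz₀]
  exact congrArg (α.inChart x₀ _) (funext fun i => (fderiv_transition_apply hz hz₀ (v i)).symm)

lemma DForm.IsSmooth.d_eq_inChart_comp {α : DForm 𝓘(ℝ, E) M m} (hα : α.IsSmooth)
    (hx : x ∈ (extChartAt 𝓘(ℝ, E) x₀).source) :
    α.d x = (extDeriv (α.inChart x₀) (extChartAt 𝓘(ℝ, E) x₀ x)).compContinuousLinearMap
      (mfderiv 𝓘(ℝ, E) 𝓘(ℝ, E) (extChartAt 𝓘(ℝ, E) x₀) x) := by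
  have hfx : (extChartAt 𝓘(ℝ, E) x₀ ∘ (extChartAt 𝓘(ℝ, E) x).symm) (extChartAt 𝓘(ℝ, E) x x) =
      extChartAt 𝓘(ℝ, E) x₀ x := congrArg _ (extChartAt_to_inv x)
  have hdiff : DifferentiableAt ℝ (α.inChart x₀) (extChartAt 𝓘(ℝ, E) x₀ x) :=
    (hα.contDiffAt_inChart ((extChartAt 𝓘(ℝ, E) x₀).map_source hx)).differentiableAt (by simp)
  have hd := extDeriv_pullback (hfx ▸ hdiff) (contDiffAt_transition hx)
    (by simpa using (ENat.LEInfty.out : (2 : WithTop ℕ∞) ≤ ∞))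
  ext v
  change extDerivWithin (α.inChart x) (range 𝓘(ℝ, E)) (extChartAt 𝓘(ℝ, E) x x) _ =
    extDeriv (α.inChart x₀) (extChartAt 𝓘(ℝ, E) x₀ x) _
  rw [ModelWithCorners.range_eq_univ, extDerivWithin_univ,
    (α.inChart_eventuallyEq_pullback hx).extDeriv_eq, hd, hfx, ← fderiv_transition_comp_mfderiv hx]
  rfl

lemma DForm.IsSmooth.d_one_apply {α : DForm 𝓘(ℝ, E) M 1} (hα : α.IsSmooth)
    (hx : x ∈ (extChartAt 𝓘(ℝ, E) x₀).source) (v w : TangentSpace 𝓘(ℝ, E) x) :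
    α.d x ![v, w] = extDeriv (α.inChart x₀) (extChartAt 𝓘(ℝ, E) x₀ x)
      ![mfderiv 𝓘(ℝ, E) 𝓘(ℝ, E) (extChartAt 𝓘(ℝ, E) x₀) x v,
        mfderiv 𝓘(ℝ, E) 𝓘(ℝ, E) (extChartAt 𝓘(ℝ, E) x₀) x w] := by
  rw [hα.d_eq_inChart_comp hx]
  exact congrArg (extDeriv (α.inChart x₀) _) (by ext i; fin_cases i <;> rfl)

end ExteriorDerivative

section OneForms

variable {E : Type*} [NormedAddCommGroup E] [NormedSpace ℝ E]

/-- A 1-form as a linear functional. -/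
def oneForm : (E [⋀^Fin 1]→L[ℝ] ℝ) ≃L[ℝ] (E →L[ℝ] ℝ) :=
  (ContinuousAlternatingMap.ofSubsingletonLIE (𝕜 := ℝ) (E := E) (F := ℝ)
    (i := (0 : Fin 1))).symm.toContinuousLinearEquiv

lemma oneForm_apply (τ : E [⋀^Fin 1]→L[ℝ] ℝ) (v : E) : oneForm τ v = τ ![v] :=
  congrArg τ (by ext i; fin_cases i; rfl)

variable {τ η : E → E [⋀^Fin 1]→L[ℝ] ℝ} {y : E}

lemma differentiableAt_one_apply (hτ : DifferentiableAt ℝ τ y) (u : E) :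
    DifferentiableAt ℝ (fun z => τ z ![u]) y := by
  simp_rw [← oneForm_apply]
  exact (oneForm.differentiableAt.comp y hτ).clm_apply (differentiableAt_const u)

lemma extDeriv_one_apply (hτ : DifferentiableAt ℝ τ y) (v w : E) :
    extDeriv τ y ![v, w] = fderiv ℝ (fun z => τ z ![w]) y v - fderiv ℝ (fun z => τ z ![v]) y w := by
  have h₀ : (0 : Fin 2).removeNth ![v, w] = ![w] := by ext i; fin_cases i; rfl
  have h₁ : (1 : Fin 2).removeNth ![v, w] = ![v] := by ext i; fin_cases i; rfl
  rw [extDeriv_apply hτ, Fin.sum_univ_two]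
  simp [h₀, h₁, sub_eq_add_neg]

lemma extDeriv_smul_apply_of_ker {c : E → ℝ} (hτ : DifferentiableAt ℝ τ y)
    (hc : DifferentiableAt ℝ c y) {v w : E} (hv : τ y ![v] = 0) (hw : τ y ![w] = 0) :
    extDeriv (fun z => c z • τ z) y ![v, w] = c y * extDeriv τ y ![v, w] := by
  have hd : ∀ u u', τ y ![u] = 0 → fderiv ℝ (fun z => (c z • τ z) ![u]) y u' =
      c y * fderiv ℝ (fun z => τ z ![u]) y u' := fun u u' hu => by
    change fderiv ℝ (fun z => c z * τ z ![u]) y u' = _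
    rw [fderiv_fun_mul hc (differentiableAt_one_apply hτ u)]
    simp [hu]
  rw [extDeriv_one_apply (τ := fun z => c z • τ z) (hc.smul hτ), extDeriv_one_apply hτ,
    hd _ _ hv, hd _ _ hw, mul_sub]

lemma eq_div_smul_of_ker_le {f g : E →ₗ[ℝ] ℝ} (hker : ∀ u, f u = 0 → g u = 0) {r : E}
    (hr : f r ≠ 0) : g = (g r / f r) • f := by
  ext u
  have hu := hker (u - (f u / f r) • r) (by simp [hr])
  rw [map_sub, map_smul, sub_eq_zero, smul_eq_mul] at hu
  rw [hu, LinearMap.smul_apply, smul_eq_mul]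
  ring

lemma extDeriv_eq_div_mul_of_ker_le (hτ : DifferentiableAt ℝ τ y) (hη : DifferentiableAt ℝ η y)
    (hker : ∀ z u, τ z ![u] = 0 → η z ![u] = 0) {r : E} (hr : τ y ![r] ≠ 0) {v w : E}
    (hv : τ y ![v] = 0) (hw : τ y ![w] = 0) :
    extDeriv η y ![v, w] = η y ![r] / τ y ![r] * extDeriv τ y ![v, w] := by
  have hτr := differentiableAt_one_apply hτ r
  have hη' : η =ᶠ[𝓝 y] fun z => (η z ![r] / τ z ![r]) • τ z := by
    filter_upwards [hτr.continuousAt.eventually_ne hr] with z hz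
    refine oneForm.injective (ContinuousLinearMap.coe_injective ?_)
    simp only [← oneForm_apply] at hz hker ⊢
    rw [map_smul]
    exact eq_div_smul_of_ker_le (hker z) hz
  have hquot : DifferentiableAt ℝ (fun z => η z ![r] / τ z ![r]) y := by
    simp only [div_eq_mul_inv]
    exact (differentiableAt_one_apply hη r).fun_mul (hτr.fun_inv hr)
  rw [hη'.extDeriv_eq, extDeriv_smul_apply_of_ker hτ hquot hv hw]

end OneForms

section ContactForms

variable {k : ℕ} {V : Type*} [TopologicalSpace V]
  [ChartedSpace (EuclideanSpace ℝ (Fin (2 * k + 1))) V] (ξ : ContactStructure k V)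

lemma ContactStructure.exists_mem_posSide (x : V) : ∃ r, r ∈ ξ.posSide x := by
  obtain ⟨α, -, hne, -, hpos, -⟩ := ξ.exists_form
  obtain ⟨v, hv⟩ := DFunLike.ne_iff.1 (hne x)
  have hv' : α x ![v 0] ≠ 0 := by rwa [show ![v 0] = v from by ext i; fin_cases i; rfl]
  refine ⟨α x ![v 0] • v 0, (hpos x _).2 ?_⟩
  rw [(α x).vecCons_smul]
  exact mul_self_pos.2 hv'

variable {ξ} [IsManifold (𝓡 (2 * k + 1)) ∞ V]

lemma ContactStructure.IsContactForm.exists_d_eq {α l : DForm (𝓡 (2 * k + 1)) V 1}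
    (hα : ξ.IsContactForm α) (hl : ξ.IsContactForm l) (x : V) :
    ∃ c : ℝ, 0 < c ∧ ∀ v ∈ ξ.plane x, ∀ w ∈ ξ.plane x, l.d x ![v, w] = c * α.d x ![v, w] := by
  have : IsManifold (𝓡 (2 * k + 1)) 1 V := IsManifold.of_le (n := ∞) (by simp)
  have hx := mem_extChartAt_source (I := 𝓡 (2 * k + 1)) x
  have hdiff : ∀ β, ξ.IsContactForm β →
      DifferentiableAt ℝ (β.inChart x) (extChartAt (𝓡 (2 * k + 1)) x x) := fun β hβ =>
    (hβ.smooth.contDiffAt_inChart (mem_extChartAt_target x)).differentiableAt (by simp)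
  obtain ⟨r, hr⟩ := ξ.exists_mem_posSide x
  have hαr := (hα.mem_posSide_iff x r).1 hr
  refine ⟨l x ![r] / α x ![r], div_pos ((hl.mem_posSide_iff x r).1 hr) hαr, fun v hv w hw => ?_⟩
  rw [hα.mem_plane_iff, α.one_apply_eq_inChart hx] at hv hw
  rw [α.one_apply_eq_inChart hx] at hαr
  rw [hl.smooth.d_one_apply hx, hα.smooth.d_one_apply hx, l.one_apply_eq_inChart hx,
    α.one_apply_eq_inChart hx]
  refine extDeriv_eq_div_mul_of_ker_le (hdiff α hα) (hdiff l hl) (fun z u hu => ?_) hαr.ne' hv hw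
  rw [DForm.inChart_one_apply, ← hl.mem_plane_iff, hα.mem_plane_iff]
  rwa [DForm.inChart_one_apply] at hu

end ContactForms

section Immersions

variable {E : Type*} [NormedAddCommGroup E] [NormedSpace ℝ E] {H : Type*} [TopologicalSpace H]
  {I : ModelWithCorners ℝ E H} {M : Type*} [TopologicalSpace M] [ChartedSpace H M]
  {E' : Type*} [NormedAddCommGroup E'] [NormedSpace ℝ E'] {H' : Type*} [TopologicalSpace H']
  {I' : ModelWithCorners ℝ E' H'} {N : Type*} [TopologicalSpace N] [ChartedSpace H' N]
  [I.Boundaryless] {n : WithTop ℕ∞} {f : M → N} {x : M}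

lemma exists_contMDiffAt_leftInverse_of_isImmersionAt (h : Manifold.IsImmersionAt I I' n f x) :
    ∃ r : N → M, (∀ᶠ p in 𝓝 (f x), ContMDiffAt I' I n r p) ∧ ∀ᶠ z in 𝓝 x, r (f z) = z := by
  let φ := h.domChart
  let ψ := h.codChart
  let g : E' → E := fun y => (h.equiv.symm y).1
  have hg : ContDiff ℝ n g := contDiff_fst.comp h.equiv.symm.contDiff
  have hφ : ∀ z ∈ φ.source, φ.extend I z ∈ (φ.extend I).target := fun z hz =>
    (φ.extend I).map_source (φ.extend_source (I := I) ▸ hz)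
  have hgf : ∀ z ∈ φ.source, g (ψ.extend I' (f z)) = φ.extend I z := fun z hz => by
    have hz' := h.writtenInCharts (hφ z hz)
    simp only [Function.comp_apply] at hz'
    rw [φ.extend_left_inv (I := I) hz] at hz'
    simp only [g, ψ, φ, hz', ContinuousLinearEquiv.symm_apply_apply]
  have hx : x ∈ φ.source := h.mem_domChart_source
  refine ⟨(φ.extend I).symm ∘ g ∘ ψ.extend I', ?_,
    Filter.eventually_of_mem (φ.open_source.mem_nhds hx) fun z hz =>
      (congrArg _ (hgf z hz)).trans (φ.extend_left_inv hz)⟩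
  have hgψ : ContinuousAt (g ∘ ψ.extend I') (f x) :=
    hg.continuous.continuousAt.comp (ψ.continuousAt_extend h.mem_codChart_source)
  have htarget : ∀ᶠ p in 𝓝 (f x), (g ∘ ψ.extend I') p ∈ (φ.extend I).target := by
    refine hgψ.eventually_mem ((φ.isOpen_extend_target (I := I)).mem_nhds ?_)
    rw [Function.comp_apply, hgf x hx]
    exact hφ x hx
  filter_upwards [ψ.open_source.mem_nhds h.mem_codChart_source, htarget] with p hp hp'
  have hψ : ContMDiffAt I' 𝓘(ℝ, E') n (ψ.extend I') p :=
    OpenPartialHomeomorph.contMDiffAt_extend h.codChart_mem_maximalAtlas hp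
  have hsymm : ContMDiffAt 𝓘(ℝ, E) I n (φ.extend I).symm ((g ∘ ψ.extend I') p) := by
    refine (contMDiffOn_extend_symm h.domChart_mem_maximalAtlas).contMDiffAt ?_
    rw [← φ.extend_target']
    exact (φ.isOpen_extend_target (I := I)).mem_nhds hp'
  exact hsymm.comp p (hg.contMDiff.contMDiffAt.comp p hψ)

lemma mfderiv_injective_of_isImmersionAt (h : Manifold.IsImmersionAt I I' n f x) (hn : n ≠ 0) :
    Function.Injective (mfderiv I I' f x) := by
  obtain ⟨r, hr, hrf⟩ := exists_contMDiffAt_leftInverse_of_isImmersionAt h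
  have hcomp : HasMFDerivAt I I (r ∘ f) x ((mfderiv I' I r (f x)).comp (mfderiv I I' f x)) :=
    (hr.self_of_nhds.mdifferentiableAt hn).hasMFDerivAt.comp x
      (h.contMDiffAt.mdifferentiableAt hn).hasMFDerivAt
  have hid : HasMFDerivAt I I (r ∘ f) x (ContinuousLinearMap.id ℝ (TangentSpace I x)) :=
    (hasMFDerivAt_id x).congr_of_eventuallyEq hrf
  exact Function.LeftInverse.injective (g := mfderiv I' I r (f x)) fun v =>
    DFunLike.congr_fun (hasMFDerivAt_unique hcomp hid) v

end Immersions

section Openness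

variable {X : Type*} [TopologicalSpace X] {T : Type*} [NormedAddCommGroup T] [NormedSpace ℝ T]

lemma continuousAt_two_apply {δ : X → T [⋀^Fin 2]→L[ℝ] ℝ} {v w : X → T} {x₀ : X}
    (hδ : ContinuousAt δ x₀) (hv : ContinuousAt v x₀) (hw : ContinuousAt w x₀) :
    ContinuousAt (fun x => δ x ![v x, w x]) x₀ := by
  refine hδ.eval (continuousAt_pi.2 fun i => ?_)
  fin_cases i
  exacts [hv, hw]

lemma eventually_forall_pos_of_quadratic [FiniteDimensional ℝ T] {f : X → T → ℝ} {x₀ : X}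
    (hf : ∀ v, ContinuousAt (fun z : X × T => f z.1 z.2) (x₀, v))
    (hq : ∀ x (c : ℝ) v, f x (c • v) = c ^ 2 * f x v) (hpos : ∀ v, v ≠ 0 → 0 < f x₀ v) :
    ∀ᶠ x in 𝓝 x₀, ∀ v, v ≠ 0 → 0 < f x v := by
  have hsphere : ∀ᶠ x in 𝓝 x₀, ∀ v ∈ Metric.sphere (0 : T) 1, 0 < f x v :=
    (isCompact_sphere (0 : T) 1).eventually_forall_of_forall_eventually fun v hv =>
      (hf v).eventually_const_lt (hpos v (ne_zero_of_mem_unit_sphere ⟨v, hv⟩))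
  filter_upwards [hsphere] with x hx v hv
  have hunit := hx (‖v‖⁻¹ • v) (by simp [norm_smul, hv])
  rw [hq] at hunit
  exact pos_of_mul_pos_right hunit (sq_nonneg _)

end Openness

section ConvexAlong

variable {E : Type*} [NormedAddCommGroup E] {F : Type*} [NormedAddCommGroup F] [NormedSpace ℝ F]

/-- The endomorphism `K` preserves the image of the subspace `P` under `L`, and is tamed there by
the 2-form `δ`. If `L` is the differential of the inclusion of a hypersurface, `P` a hyperplane in
its tangent space, `δ` the exterior derivative of a 1-form with kernel `P`, and `K` an almost
complex structure, this is pseudoconvexity of the hypersurface at a point. -/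
def IsConvexAlong {T S : Type*} [AddCommGroup T] [Module ℝ T] [TopologicalSpace T] [AddCommGroup S]
    [Module ℝ S] [TopologicalSpace S] (L : S →L[ℝ] T) (P : Submodule ℝ S) (δ : S [⋀^Fin 2]→L[ℝ] ℝ)
    (K : T →L[ℝ] T) : Prop :=
  ∀ u ∈ P, u ≠ 0 → ∃ w ∈ P, L w = K (L u) ∧ 0 < δ ![u, w]

lemma isConvexAlong_iff_of_leftInverse {T S : Type*} [AddCommGroup T] [Module ℝ T]
    [TopologicalSpace T] [AddCommGroup S] [Module ℝ S] [TopologicalSpace S] {L : S →L[ℝ] T}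
    {P : Submodule ℝ S} {δ : S [⋀^Fin 2]→L[ℝ] ℝ} {K : T →L[ℝ] T} {Λ : T →ₗ[ℝ] S}
    (hΛ : ∀ u, Λ (L u) = u) :
    IsConvexAlong L P δ K ↔ (∀ v ∈ P.map L.toLinearMap, K v ∈ P.map L.toLinearMap) ∧
      ∀ v ∈ P.map L.toLinearMap, v ≠ 0 → 0 < (altBilin δ).compl₁₂ Λ Λ v (K v) := by
  refine ⟨fun h => ⟨?_, ?_⟩, fun ⟨hP, hδ⟩ u hu hu0 => ?_⟩
  · rintro _ ⟨u, hu, rfl⟩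
    obtain rfl | hu0 := eq_or_ne u 0
    · simp
    · obtain ⟨w, hw, hwK, -⟩ := h u hu hu0
      exact ⟨w, hw, hwK⟩
  · rintro _ ⟨u, hu, rfl⟩ hu0
    obtain ⟨w, -, hwK, hw⟩ := h u hu (by rintro rfl; simp at hu0)
    rw [ContinuousLinearMap.coe_coe, LinearMap.compl₁₂_apply, ← hwK, hΛ, hΛ]
    exact hw
  · have hLu : L u ∈ P.map L.toLinearMap := Submodule.mem_map_of_mem hu
    obtain ⟨w, hw, hwK⟩ := hP _ hLu
    refine ⟨w, hw, hwK, ?_⟩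
    have hpos := hδ _ hLu fun h0 => hu0 (by rw [← hΛ u, h0, map_zero])
    rwa [← hwK, LinearMap.compl₁₂_apply, ContinuousLinearMap.coe_coe, hΛ, hΛ] at hpos

lemma convex_setOf_forall_pos {T : Type*} [AddCommGroup T] [Module ℝ T] [TopologicalSpace T]
    [IsTopologicalAddGroup T] [ContinuousConstSMul ℝ T] (B : T [⋀^Fin 2]→L[ℝ] ℝ) :
    Convex ℝ {K : T →L[ℝ] T | ∀ v, v ≠ 0 → 0 < B ![v, K v]} := by
  intro K hK K' hK' a b ha hb hab v hv
  have h : 0 < a • B ![v, K v] + b • B ![v, K' v] :=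
    convex_Ioi (0 : ℝ) (hK v hv) (hK' v hv) ha hb hab
  simpa only [← altBilin_apply, add_apply, smul_apply, map_add, map_smul] using h

lemma convex_setOf_isConvexAlong {T S : Type*} [AddCommGroup T] [Module ℝ T] [TopologicalSpace T]
    [IsTopologicalAddGroup T] [ContinuousConstSMul ℝ T] [AddCommGroup S] [Module ℝ S]
    [TopologicalSpace S] (L : S →L[ℝ] T) (P : Submodule ℝ S) (δ : S [⋀^Fin 2]→L[ℝ] ℝ) :
    Convex ℝ {K : T →L[ℝ] T | IsConvexAlong L P δ K} := by
  intro K hK K' hK' a b ha hb hab u hu hu0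
  obtain ⟨w, hw, hwK, hwδ⟩ := hK u hu hu0
  obtain ⟨w', hw', hwK', hwδ'⟩ := hK' u hu hu0
  refine ⟨a • w + b • w', P.add_mem (P.smul_mem _ hw) (P.smul_mem _ hw'), ?_, ?_⟩
  · rw [map_add, map_smul, map_smul, hwK, hwK', add_apply, smul_apply, smul_apply]
  · have h : 0 < a • δ ![u, w] + b • δ ![u, w'] := convex_Ioi (0 : ℝ) hwδ hwδ' ha hb hab
    simpa only [← altBilin_apply, map_add, map_smul] using h

lemma exists_leftInverse_of_injective {T S : Type*} [AddCommGroup T] [Module ℝ T]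
    [TopologicalSpace T] [AddCommGroup S] [Module ℝ S] [TopologicalSpace S] {L : S →L[ℝ] T}
    (hL : Function.Injective L) : ∃ Λ : T →ₗ[ℝ] S, ∀ u, Λ (L u) = u := by
  obtain ⟨Λ, hΛ⟩ := L.toLinearMap.exists_leftInverse_of_injective (LinearMap.ker_eq_bot.2 hL)
  exact ⟨Λ, DFunLike.congr_fun hΛ⟩

lemma IsRotatable.isConvexAlong_rotAvg [NormedSpace ℝ E] [FiniteDimensional ℝ E] {K : E →L[ℝ] E}
    (hK : IsRotatable K) {L : F →L[ℝ] E} (hL : Function.Injective L) {P : Submodule ℝ F}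
    {δ : F [⋀^Fin 2]→L[ℝ] ℝ} (h : IsConvexAlong L P δ K) :
    IsConvexAlong L P δ (rotAvg K) := by
  obtain ⟨Λ, hΛ⟩ := exists_leftInverse_of_injective hL
  obtain ⟨hP, hδ⟩ := (isConvexAlong_iff_of_leftInverse hΛ).1 h
  exact (isConvexAlong_iff_of_leftInverse hΛ).2 ⟨fun v hv => hK.rotAvg_apply_mem hP hv,
    fun v hv hv0 => hK.rotAvg_tame hP (fun v => isAlt_altBilin δ (Λ v)) hδ hv hv0⟩

lemma exists_tame_isConvexAlong [InnerProductSpace ℝ E] [FiniteDimensional ℝ E]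
    {B : E [⋀^Fin 2]→L[ℝ] ℝ} {D : F →L[ℝ] E} {δ : F [⋀^Fin 2]→L[ℝ] ℝ} {P : Submodule ℝ F}
    (hD : Function.Injective D) (hB : NondegenerateOn B ⊤)
    (h : ∀ b ∈ segment ℝ (B.compContinuousLinearMap D) δ, NondegenerateOn b P) :
    ∃ K : E →L[ℝ] E, (∀ v, v ≠ 0 → 0 < B ![v, K v]) ∧ IsConvexAlong D P δ K := by
  obtain ⟨Λ, hΛ⟩ := exists_leftInverse_of_injective hD
  obtain ⟨K, hK, hKP, hKδ⟩ := exists_tame_preserving (B₁ := (altBilin δ).compl₁₂ Λ Λ)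
    (isAlt_altBilin B) (fun v hv => hB v trivial fun w _ => hv w) (P.map D.toLinearMap) (by
      rintro _ ⟨s, t, hs, ht, hst, rfl⟩ ⟨_, u, hu, rfl⟩ hv
      refine Subtype.ext (LinearMap.map_eq_zero_iff _ hD |>.2
        (h _ ⟨s, t, hs, ht, hst, rfl⟩ u hu fun w hw => ?_))
      have huw : s * B ![D u, D w] + t * δ ![Λ (D u), Λ (D w)] = 0 :=
        hv ⟨D w, Submodule.mem_map_of_mem hw⟩
      rw [hΛ, hΛ] at huw
      rw [← huw]
      exact congrArg (fun e => s * B e + t * δ ![u, w]) (by ext i; fin_cases i <;> rfl))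
  exact ⟨K, hK, (isConvexAlong_iff_of_leftInverse hΛ).2 ⟨hKP, hKδ⟩⟩

end ConvexAlong

section LinearFamilies

variable {E : Type*} [NormedAddCommGroup E] {F : Type*} [NormedAddCommGroup F] [NormedSpace ℝ F]

lemma eventually_forall_pos_of_leftInverse_ker [NormedSpace ℝ E] [FiniteDimensional ℝ F]
    {X : Type*} [TopologicalSpace X] {y₀ : X} {D : X → F →L[ℝ] E} {a : X → F →L[ℝ] ℝ}
    {δ : X → F [⋀^Fin 2]→L[ℝ] ℝ} {P : X → E →L[ℝ] F} {K : E →L[ℝ] E}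
    (hD : ContinuousAt D y₀) (ha : ContinuousAt a y₀) (hδ : ContinuousAt δ y₀)
    (hP : ContinuousAt P y₀) (haP : ∀ v, a y₀ (P y₀ v) = 0)
    (hPD : ∀ᶠ y in 𝓝 y₀, ∀ u, a y u = 0 → P y (D y u) = u)
    (hpos : ∀ u, u ≠ 0 → a y₀ u = 0 → 0 < δ y₀ ![u, P y₀ (K (D y₀ u))]) :
    ∀ᶠ y in 𝓝 y₀, ∀ u, u ≠ 0 → a y u = 0 → 0 < δ y ![u, P y (K (D y u))] := by
  let f : X → F → ℝ := fun y u =>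
    δ y ![P y (D y u), P y (K (D y (P y (D y u))))] + a y u ^ 2
  have hf : ∀ᶠ y in 𝓝 y₀, ∀ u, u ≠ 0 → 0 < f y u := by
    refine eventually_forall_pos_of_quadratic (fun u => ?_) (fun y c u => ?_) fun u hu => ?_
    · have hfst : ContinuousAt Prod.fst (y₀, u) := continuousAt_fst
      have hDz : ContinuousAt (fun z : X × F => D z.1) (y₀, u) :=
        ContinuousAt.comp (x := (y₀, u)) hD hfst
      have hPz : ContinuousAt (fun z : X × F => P z.1) (y₀, u) :=
        ContinuousAt.comp (x := (y₀, u)) hP hfst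
      have haz : ContinuousAt (fun z : X × F => a z.1) (y₀, u) :=
        ContinuousAt.comp (x := (y₀, u)) ha hfst
      have hPDz := hPz.clm_apply (hDz.clm_apply continuousAt_snd)
      refine (continuousAt_two_apply (ContinuousAt.comp (x := (y₀, u)) hδ hfst) hPDz
        (hPz.clm_apply (K.continuous.continuousAt.comp (hDz.clm_apply hPDz)))).add
          ((haz.clm_apply continuousAt_snd).pow 2)
    · simp only [f, map_smul, smul_eq_mul, ← altBilin_apply, LinearMap.smul_apply]
      ring
    · obtain hPu | hPu := eq_or_ne (P y₀ (D y₀ u)) 0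
      · have hau : a y₀ u ≠ 0 := fun hau => hu ((hPD.self_of_nhds u hau).symm.trans hPu)
        simp only [f, hPu, ← altBilin_apply, map_zero, zero_add]
        positivity
      · exact add_pos_of_pos_of_nonneg (hpos _ hPu (haP _)) (sq_nonneg _)
  filter_upwards [hf, hPD] with y hfy hPy u hu hau
  have h := hfy u hu
  simpa only [f, hPy u hau, hau, ne_eq, OfNat.ofNat_ne_zero, not_false_eq_true, zero_pow,
    add_zero] using h

variable [NormedSpace ℝ E] [FiniteDimensional ℝ E] [FiniteDimensional ℝ F]
  {X : Type*} [NormedAddCommGroup X] [NormedSpace ℝ X] {y₀ : X} {D : X → F →L[ℝ] E}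
  {a : X → F →L[ℝ] ℝ} {δ : X → F [⋀^Fin 2]→L[ℝ] ℝ}

lemma exists_contDiffAt_leftInverse (hD : ∀ᶠ y in 𝓝 y₀, ContDiffAt ℝ ∞ D y)
    (hinj : Function.Injective (D y₀)) :
    ∃ Λ : X → E →L[ℝ] F, (∀ᶠ y in 𝓝 y₀, ContDiffAt ℝ ∞ Λ y) ∧
      ∀ᶠ y in 𝓝 y₀, ∀ u, Λ y (D y u) = u := by
  obtain ⟨Λ', hΛ'⟩ := exists_leftInverse_of_injective hinj
  let Λ₀ : E →L[ℝ] F := LinearMap.toContinuousLinearMap Λ'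
  have hunit : ∀ᶠ y in 𝓝 y₀, IsUnit (Λ₀ ∘L D y) := by
    have hcont : ContinuousAt (fun y => Λ₀ ∘L D y) y₀ :=
      continuousAt_const.clm_comp hD.self_of_nhds.continuousAt
    have hone : Λ₀ ∘L D y₀ = 1 := ContinuousLinearMap.ext hΛ'
    exact hcont.eventually_mem (Units.isOpen.mem_nhds (hone ▸ isUnit_one))
  refine ⟨fun y => Ring.inverse (Λ₀ ∘L D y) ∘L Λ₀, ?_, ?_⟩
  · filter_upwards [hD, hunit] with y hDy ⟨w, hw⟩
    have hcomp : ContDiffAt ℝ ∞ (fun y => Λ₀ ∘L D y) y := contDiffAt_const.clm_comp hDy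
    have hinv : ContDiffAt ℝ ∞ Ring.inverse (Λ₀ ∘L D y) := hw ▸ contDiffAt_ringInverse (n := ∞) ℝ w
    exact (ContDiffAt.comp (g := Ring.inverse) y hinv hcomp).clm_comp contDiffAt_const
  · filter_upwards [hunit] with y hy u
    exact DFunLike.congr_fun (Ring.inverse_mul_cancel _ hy) u

lemma exists_contDiffAt_leftInverse_ker (hD : ∀ᶠ y in 𝓝 y₀, ContDiffAt ℝ ∞ D y)
    (ha : ∀ᶠ y in 𝓝 y₀, ContDiffAt ℝ ∞ a y) (hinj : Function.Injective (D y₀)) (ha₀ : a y₀ ≠ 0) :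
    ∃ P : X → E →L[ℝ] F, (∀ᶠ y in 𝓝 y₀, ContDiffAt ℝ ∞ P y) ∧
      ∀ᶠ y in 𝓝 y₀, (∀ v, a y (P y v) = 0) ∧ ∀ u, a y u = 0 → P y (D y u) = u := by
  obtain ⟨Λ, hΛ, hΛD⟩ := exists_contDiffAt_leftInverse hD hinj
  obtain ⟨ρ, hρ⟩ := DFunLike.ne_iff.1 ha₀
  have haρ : ∀ᶠ y in 𝓝 y₀, a y ρ ≠ 0 :=
    (ha.self_of_nhds.continuousAt.clm_apply continuousAt_const).eventually_ne hρ
  let q : X → F →L[ℝ] F := fun y => .id ℝ F - (a y ρ)⁻¹ • (a y).smulRight ρ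
  have hq : ∀ y u, q y u = u - ((a y ρ)⁻¹ * a y u) • ρ := fun y u => by
    simp [q, mul_smul]
  refine ⟨fun y => q y ∘L Λ y, ?_, ?_⟩
  · filter_upwards [hΛ, ha, haρ] with y hΛy hay hρy
    have hinv : ContDiffAt ℝ ∞ (fun y => (a y ρ)⁻¹) y := (hay.clm_apply contDiffAt_const).inv hρy
    exact (contDiffAt_const.sub (hinv.smul (hay.smulRight contDiffAt_const))).clm_comp hΛy
  · filter_upwards [hΛD, haρ] with y hy hρy
    refine ⟨fun v => ?_, fun u hu => ?_⟩
    · rw [ContinuousLinearMap.comp_apply, hq, map_sub, map_smul, smul_eq_mul, mul_right_comm,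
        inv_mul_cancel₀ hρy, one_mul, sub_self]
    · rw [ContinuousLinearMap.comp_apply, hy, hq, hu, mul_zero, zero_smul, sub_zero]

lemma exists_contDiffAt_isConvexAlong_ker (hD : ∀ᶠ y in 𝓝 y₀, ContDiffAt ℝ ∞ D y)
    (ha : ∀ᶠ y in 𝓝 y₀, ContDiffAt ℝ ∞ a y) (hδ : ContinuousAt δ y₀)
    (hinj : Function.Injective (D y₀)) (ha₀ : a y₀ ≠ 0) {K : E →L[ℝ] E}
    (hK : IsConvexAlong (D y₀) (a y₀).ker (δ y₀) K) :
    ∃ κ : X → E →L[ℝ] E, (∀ᶠ y in 𝓝 y₀, ContDiffAt ℝ ∞ κ y) ∧ κ y₀ = K ∧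
      ∀ᶠ y in 𝓝 y₀, IsConvexAlong (D y) (a y).ker (δ y) (κ y) := by
  obtain ⟨P, hP, hPD⟩ := exists_contDiffAt_leftInverse_ker hD ha hinj ha₀
  obtain ⟨haP₀, hPD₀⟩ := hPD.self_of_nhds
  let Q : X → E →L[ℝ] E := fun y => D y ∘L P y
  let κ : X → E →L[ℝ] E := fun y => Q y ∘L K ∘L Q y + K ∘L (.id ℝ E - Q y)
  have hκ : ∀ y v, κ y v = D y (P y (K (D y (P y v)))) + K (v - D y (P y v)) := fun y v => rfl
  refine ⟨κ, ?_, ContinuousLinearMap.ext fun v => ?_, ?_⟩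
  · filter_upwards [hD, hP] with y hDy hPy
    have hQ : ContDiffAt ℝ ∞ Q y := hDy.clm_comp hPy
    exact (hQ.clm_comp (contDiffAt_const.clm_comp hQ)).add
      (contDiffAt_const.clm_comp (contDiffAt_const.sub hQ))
  · obtain hPv | hPv := eq_or_ne (P y₀ v) 0
    · simp only [hκ, hPv, map_zero, sub_zero, zero_add]
    · obtain ⟨w, haw, hDw, -⟩ := hK (P y₀ v) (haP₀ v) hPv
      rw [hκ, map_sub, ← hDw, hPD₀ w haw, add_sub_cancel]
  · have hpos : ∀ᶠ y in 𝓝 y₀, ∀ u, u ≠ 0 → a y u = 0 → 0 < δ y ![u, P y (K (D y u))] := by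
      refine eventually_forall_pos_of_leftInverse_ker hD.self_of_nhds.continuousAt
        ha.self_of_nhds.continuousAt hδ hP.self_of_nhds.continuousAt haP₀
        (hPD.mono fun y hy => hy.2) fun u hu hau => ?_
      obtain ⟨w, haw, hDw, hδw⟩ := hK u hau hu
      rwa [← hDw, hPD₀ w haw]
    filter_upwards [hPD, hpos] with y hPy hδy u hau hu
    refine ⟨P y (K (D y u)), hPy.1 _, ?_, hδy u hu hau⟩
    rw [hκ, hPy.2 u hau, sub_self, map_zero, add_zero]

end LinearFamilies

section EndomorphismFields

variable {E : Type*} [NormedAddCommGroup E] [NormedSpace ℝ E] {H : Type*} [TopologicalSpace H]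
  {I : ModelWithCorners ℝ E H} {M : Type*} [TopologicalSpace M] [ChartedSpace H M]
  [IsManifold I 1 M]

/-- A field of endomorphisms of the tangent spaces, as a map into the total space of the
endomorphism bundle of the tangent bundle. -/
abbrev endSection (s : ∀ p : M, TangentSpace I p →L[ℝ] TangentSpace I p) (p : M) :
    Bundle.TotalSpace (E →L[ℝ] E) fun p : M => TangentSpace I p →L[ℝ] TangentSpace I p :=
  Bundle.TotalSpace.mk' (E →L[ℝ] E)
    (E := fun p : M => TangentSpace I p →L[ℝ] TangentSpace I p) p (s p)

/-- The coordinate expression of a field of endomorphisms of the tangent spaces, in the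
trivialization of the tangent bundle over the chart at `p₀`. -/
def endInChart (p₀ : M) (s : ∀ p : M, TangentSpace I p →L[ℝ] TangentSpace I p) (p : M) :
    E →L[ℝ] E :=
  ContinuousLinearMap.inCoordinates E (TangentSpace I (M := M)) E (TangentSpace I (M := M))
    p₀ p p₀ p (s p)

lemma exists_algHom_forall_eq_endInChart {p₀ p : M} (hp : p ∈ (chartAt H p₀).source) :
    ∃ f : (E →L[ℝ] E) →ₐ[ℝ] (E →L[ℝ] E), Continuous f ∧
      ∀ s : (∀ p : M, TangentSpace I p →L[ℝ] TangentSpace I p), f (s p) = endInChart p₀ s p := by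
  let e := trivializationAt E (TangentSpace I (M := M)) p₀
  have hb : p ∈ e.baseSet := hp
  let P : E ≃L[ℝ] E := e.continuousLinearEquivAt ℝ p hb
  exact ⟨P.conjContinuousAlgEquiv.toAlgEquiv.toAlgHom, P.conjContinuousAlgEquiv.continuous,
    fun s => (ContinuousLinearMap.inCoordinates_eq (ϕ := s p) hb hb).symm⟩

end EndomorphismFields

section SmoothEndomorphismFields

variable {E : Type*} [NormedAddCommGroup E] [NormedSpace ℝ E] {H : Type*} [TopologicalSpace H]
  {I : ModelWithCorners ℝ E H} {M : Type*} [TopologicalSpace M] [ChartedSpace H M]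
  [IsManifold I ∞ M]

lemma contMDiffOn_endSection_iff {p₀ : M} {s : ∀ p : M, TangentSpace I p →L[ℝ] TangentSpace I p}
    {U : Set M} (hU : IsOpen U) (hUs : U ⊆ (chartAt H p₀).source) :
    ContMDiffOn I (I.prod 𝓘(ℝ, E →L[ℝ] E)) ∞ (endSection s) U ↔
      ContMDiffOn I 𝓘(ℝ, E →L[ℝ] E) ∞ (endInChart p₀ s) U := by
  refine Bundle.Trivialization.contMDiffOn_section_iff (trivializationAt (E →L[ℝ] E)
    (fun p : M => TangentSpace I p →L[ℝ] TangentSpace I p) p₀) hU fun p hp => ?_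
  rw [hom_trivializationAt_baseSet]
  exact ⟨hUs hp, hUs hp⟩

lemma exists_contMDiffOn_endSection {p₀ : M} {κ : M → E →L[ℝ] E}
    (hκ : ∀ᶠ p in 𝓝 p₀, ContMDiffAt I 𝓘(ℝ, E →L[ℝ] E) ∞ κ p) :
    ∃ s : ∀ p : M, TangentSpace I p →L[ℝ] TangentSpace I p, ∃ U ∈ 𝓝 p₀,
      ContMDiffOn I (I.prod 𝓘(ℝ, E →L[ℝ] E)) ∞ (endSection s) U ∧
      ∀ p ∈ U, p ∈ (extChartAt I p₀).source ∧ ∀ v, mfderiv I 𝓘(ℝ, E) (extChartAt I p₀) p (s p v) =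
        κ p (mfderiv I 𝓘(ℝ, E) (extChartAt I p₀) p v) := by
  let e := trivializationAt E (TangentSpace I (M := M)) p₀
  let s : ∀ p : M, TangentSpace I p →L[ℝ] TangentSpace I p := fun p =>
    e.symmL ℝ p ∘L κ p ∘L e.continuousLinearMapAt ℝ p
  obtain ⟨U, hUκ, hUo, hUp⟩ := eventually_nhds_iff.1 hκ
  have hV : IsOpen (U ∩ (chartAt H p₀).source) := hUo.inter (chartAt H p₀).open_source
  refine ⟨s, U ∩ (chartAt H p₀).source, hV.mem_nhds ⟨hUp, mem_chart_source H p₀⟩, ?_,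
    fun p hp => ⟨extChartAt_source I p₀ ▸ hp.2, fun v => ?_⟩⟩
  · rw [contMDiffOn_endSection_iff hV inter_subset_right]
    refine ContMDiffOn.congr (fun p hp => (hUκ p hp.1).contMDiffWithinAt) fun p hp => ?_
    have hb : p ∈ e.baseSet := hp.2
    ext v
    change e.continuousLinearMapAt ℝ p (e.symmL ℝ p (κ p (e.continuousLinearMapAt ℝ p
      (e.symmL ℝ p v)))) = _
    rw [e.continuousLinearMapAt_symmL hb, e.continuousLinearMapAt_symmL hb]
  · rw [← TangentBundle.continuousLinearMapAt_trivializationAt hp.2]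
    exact e.continuousLinearMapAt_symmL (show p ∈ e.baseSet from hp.2) _

lemma contMDiff_endSection_rotAvg [CompleteSpace E]
    {K : ∀ p : M, TangentSpace I p →L[ℝ] TangentSpace I p}
    (hKs : ContMDiff I (I.prod 𝓘(ℝ, E →L[ℝ] E)) ∞ (endSection K))
    (hK : ∀ p, IsRotatable (A := E →L[ℝ] E) (K p)) :
    ContMDiff I (I.prod 𝓘(ℝ, E →L[ℝ] E)) ∞
      (endSection (I := I) fun p => rotAvg (A := E →L[ℝ] E) (K p)) := by
  have : IsManifold I 1 M := IsManifold.of_le (n := ∞) (by simp)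
  intro p₀
  have hU : IsOpen (chartAt H p₀).source := (chartAt H p₀).open_source
  refine ContMDiffOn.contMDiffAt ?_ (hU.mem_nhds (mem_chart_source H p₀))
  have hKs' := (contMDiffOn_endSection_iff hU subset_rfl).1 hKs.contMDiffOn
  refine (contMDiffOn_endSection_iff hU subset_rfl).2
    (ContMDiffOn.congr (f := fun p => rotAvg (endInChart p₀ K p)) (fun p hp => ?_) fun p hp => ?_)
  · obtain ⟨f, -, hf⟩ := exists_algHom_forall_eq_endInChart (E := E) (I := I) (p₀ := p₀) hp
    have hrot : ContDiffAt ℝ ∞ rotAvg (endInChart p₀ K p) :=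
      hf K ▸ ((hK p).map f).contDiffAt_rotAvg
    exact hrot.contMDiffAt.comp_contMDiffWithinAt p (hKs' p hp)
  · obtain ⟨f, hfc, hf⟩ := exists_algHom_forall_eq_endInChart (E := E) (I := I) (p₀ := p₀) hp
    exact (hf _).symm.trans (((hK p).map_rotAvg f hfc).trans (congrArg rotAvg (hf K)))

end SmoothEndomorphismFields

section ChartEvaluation

variable {E : Type*} [NormedAddCommGroup E] [NormedSpace ℝ E] {H : Type*} [TopologicalSpace H]
  {I : ModelWithCorners ℝ E H} {M : Type*} [TopologicalSpace M] [ChartedSpace H M]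

section

variable [IsManifold I 1 M]

lemma DForm.two_apply_eq_inChart (Ω : DForm I M 2) {x₀ x : M} (hx : x ∈ (extChartAt I x₀).source)
    (v w : TangentSpace I x) : Ω x ![v, w] =
      Ω.inChart x₀ (extChartAt I x₀ x) ![mfderiv I 𝓘(ℝ, E) (extChartAt I x₀) x v,
        mfderiv I 𝓘(ℝ, E) (extChartAt I x₀) x w] := by
  rw [Ω.eq_inChart_comp hx]
  exact congrArg (Ω.inChart x₀ _) (by ext i; fin_cases i <;> rfl)

lemma mfderiv_extChartAt_injective {x₀ x : M} (hx : x ∈ (extChartAt I x₀).source) :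
    Function.Injective (mfderiv I 𝓘(ℝ, E) (extChartAt I x₀) x) := by
  obtain ⟨e, he⟩ := isInvertible_mfderiv_extChartAt hx
  rw [← he]
  exact e.injective

lemma DForm.inChart_self_two_apply (Ω : DForm I M 2) (x : M) (v w : TangentSpace I x) :
    Ω.inChart x (extChartAt I x x) ![v, w] = Ω x ![v, w] := by
  rw [Ω.two_apply_eq_inChart (mem_extChartAt_source x), mfderiv_extChartAt_self]
  rfl

end

lemma DForm.IsSmooth.continuousAt_inChart {m : ℕ} {Ω : DForm I M m} (hΩ : Ω.IsSmooth) (x : M) :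
    ContinuousAt (fun p => Ω.inChart x (extChartAt I x p)) x := by
  have hΩx : ContinuousWithinAt (Ω.inChart x) (extChartAt I x).target (extChartAt I x x) :=
    (hΩ x).continuousOn _ (mem_extChartAt_target x)
  exact hΩx.tendsto.comp (tendsto_nhdsWithin_iff.2 ⟨continuousAt_extChartAt x,
    Filter.mem_of_superset (extChartAt_source_mem_nhds x) fun p hp =>
      (extChartAt I x).map_source hp⟩)

lemma exists_contMDiffOn_endSection_tame [IsManifold I ∞ M] [FiniteDimensional ℝ E]
    {Ω : DForm I M 2} (hΩ : Ω.IsSmooth) {p₀ : M} {κ : M → E →L[ℝ] E}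
    (hκ : ∀ᶠ p in 𝓝 p₀, ContMDiffAt I 𝓘(ℝ, E →L[ℝ] E) ∞ κ p)
    (hpos : ∀ v : E, v ≠ 0 → 0 < Ω.inChart p₀ (extChartAt I p₀ p₀) ![v, κ p₀ v]) :
    ∃ s : ∀ p : M, TangentSpace I p →L[ℝ] TangentSpace I p, ∃ U ∈ 𝓝 p₀,
      ContMDiffOn I (I.prod 𝓘(ℝ, E →L[ℝ] E)) ∞ (endSection s) U ∧
      (∀ p ∈ U, ∀ v, v ≠ 0 → 0 < Ω p ![v, s p v]) ∧
      ∀ p ∈ U, p ∈ (extChartAt I p₀).source ∧ ∀ v, mfderiv I 𝓘(ℝ, E) (extChartAt I p₀) p (s p v) =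
        κ p (mfderiv I 𝓘(ℝ, E) (extChartAt I p₀) p v) := by
  have : IsManifold I 1 M := IsManifold.of_le (n := ∞) (by simp)
  obtain ⟨s, U, hU, hs, hsκ⟩ := exists_contMDiffOn_endSection hκ
  have hev : ∀ᶠ p in 𝓝 p₀, ∀ v : E, v ≠ 0 → 0 < Ω.inChart p₀ (extChartAt I p₀ p) ![v, κ p v] := by
    refine eventually_forall_pos_of_quadratic
      (f := fun p v => Ω.inChart p₀ (extChartAt I p₀ p) ![v, κ p v]) (fun v => ?_)
      (fun p c v => ?_) hpos
    · have hfst : ContinuousAt Prod.fst (p₀, v) := continuousAt_fst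
      have hκ₀ : ContinuousAt κ p₀ := hκ.self_of_nhds.continuousAt
      exact continuousAt_two_apply
        (ContinuousAt.comp (g := fun p => Ω.inChart p₀ (extChartAt I p₀ p)) (x := (p₀, v))
          (hΩ.continuousAt_inChart p₀) hfst) continuousAt_snd
        ((ContinuousAt.comp (x := (p₀, v)) hκ₀ hfst).clm_apply continuousAt_snd)
    · simp only [← altBilin_apply, map_smul, LinearMap.smul_apply, smul_eq_mul]
      ring
  refine ⟨s, _, Filter.inter_mem hU hev, hs.mono inter_subset_left, fun p hp v hv => ?_,
    fun p hp => hsκ p hp.1⟩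
  obtain ⟨hps, hsp⟩ := hsκ p hp.1
  rw [Ω.two_apply_eq_inChart hps, hsp]
  exact hp.2 _ ((map_ne_zero_iff _ (mfderiv_extChartAt_injective hps)).2 hv)

end ChartEvaluation

section ContactMultiples

lemma DForm.d_smul {E : Type*} [NormedAddCommGroup E] [NormedSpace ℝ E] {H : Type*}
    [TopologicalSpace H] {I : ModelWithCorners ℝ E H} {M : Type*} [TopologicalSpace M]
    [ChartedSpace H M] {m : ℕ} (α : DForm I M m) (c : ℝ) (x : M) :
    DForm.d (fun x => c • α x) x = c • α.d x := by
  have hext := extDerivWithin_smul c (α.inChart x)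
    (I.uniqueDiffOn _ (mem_range_self (chartAt H x x)))
  exact congrArg (fun β => β.compContinuousLinearMap (mfderiv I 𝓘(ℝ, E) (extChartAt I x) x)) hext

lemma ContactStructure.IsContactForm.const_smul {k : ℕ} {V : Type*} [TopologicalSpace V]
    [ChartedSpace (EuclideanSpace ℝ (Fin (2 * k + 1))) V] {ξ : ContactStructure k V}
    {α : DForm (𝓡 (2 * k + 1)) V 1} (hα : ξ.IsContactForm α) {c : ℝ} (hc : 0 < c) :
    ξ.IsContactForm (fun x => c • α x) where
  smooth x₀ := (hα.smooth x₀).const_smul c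
  mem_plane_iff x v :=
    (hα.mem_plane_iff x v).trans (by simp [hc.ne'])
  mem_posSide_iff x v :=
    (hα.mem_posSide_iff x v).trans (by simp [hc])

end ContactMultiples

section MapsInCharts

variable {F : Type*} [NormedAddCommGroup F] [NormedSpace ℝ F] {M : Type*} [TopologicalSpace M]
  [ChartedSpace F M] [IsManifold 𝓘(ℝ, F) ∞ M] {E : Type*} [NormedAddCommGroup E]
  [NormedSpace ℝ E] {H : Type*} [TopologicalSpace H] {I : ModelWithCorners ℝ E H} {N : Type*}
  [TopologicalSpace N] [ChartedSpace H N] [IsManifold I ∞ N] {ι : M → N}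

lemma eventually_contDiffAt_writtenInExtChartAt (hι : ContMDiff 𝓘(ℝ, F) I ∞ ι) (x₀ : M) :
    ∀ᶠ y in 𝓝 (extChartAt 𝓘(ℝ, F) x₀ x₀),
      ContDiffAt ℝ ∞ (writtenInExtChartAt 𝓘(ℝ, F) I x₀ ι) y := by
  obtain ⟨hcont, hdiff⟩ := contMDiff_iff.1 hι
  have hsource : ∀ᶠ y in 𝓝 (extChartAt 𝓘(ℝ, F) x₀ x₀),
      ι ((extChartAt 𝓘(ℝ, F) x₀).symm y) ∈ (extChartAt I (ι x₀)).source := by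
    refine ((hcont.continuousAt).comp (continuousAt_extChartAt_symm x₀)).eventually_mem ?_
    rw [Function.comp_apply, extChartAt_to_inv]
    exact extChartAt_source_mem_nhds (ι x₀)
  filter_upwards [eventually_mem_nhds_iff.2 (Filter.inter_mem (extChartAt_target_mem_nhds x₀)
    hsource)] with y hy
  exact (hdiff x₀ (ι x₀)).contDiffAt hy

lemma mfderiv_extChartAt_mfderiv {x₀ x : M} (hι : MDifferentiableAt 𝓘(ℝ, F) I ι x)
    (hx : x ∈ (extChartAt 𝓘(ℝ, F) x₀).source) (hιx : ι x ∈ (extChartAt I (ι x₀)).source)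
    (hg : DifferentiableAt ℝ (writtenInExtChartAt 𝓘(ℝ, F) I x₀ ι) (extChartAt 𝓘(ℝ, F) x₀ x))
    (v : TangentSpace 𝓘(ℝ, F) x) :
    mfderiv I 𝓘(ℝ, E) (extChartAt I (ι x₀)) (ι x) (mfderiv 𝓘(ℝ, F) I ι x v) =
      fderiv ℝ (writtenInExtChartAt 𝓘(ℝ, F) I x₀ ι) (extChartAt 𝓘(ℝ, F) x₀ x)
        (mfderiv 𝓘(ℝ, F) 𝓘(ℝ, F) (extChartAt 𝓘(ℝ, F) x₀) x v) := by
  have : IsManifold 𝓘(ℝ, F) 1 M := IsManifold.of_le (n := ∞) (by simp)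
  have : IsManifold I 1 N := IsManifold.of_le (n := ∞) (by simp)
  have hcomm : writtenInExtChartAt 𝓘(ℝ, F) I x₀ ι ∘ extChartAt 𝓘(ℝ, F) x₀ =ᶠ[𝓝 x]
      extChartAt I (ι x₀) ∘ ι := by
    filter_upwards [extChartAt_source_mem_nhds' hx] with z hz
    simp only [writtenInExtChartAt, Function.comp_apply, (extChartAt 𝓘(ℝ, F) x₀).left_inv hz]
  have hleft := mfderiv_comp x (I'' := 𝓘(ℝ, E)) hg.mdifferentiableAt
    (mdifferentiableAt_extChartAt (I := 𝓘(ℝ, F)) (by simpa using hx))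
  have hright := mfderiv_comp x
    (mdifferentiableAt_extChartAt (I := I) (by simpa using hιx)) hι
  rw [← hcomm.mfderiv_eq, hleft, mfderiv_eq_fderiv] at hright
  exact (DFunLike.congr_fun hright v).symm

end MapsInCharts

section ConvexFields

lemma isConvexAlong_iff_of_conj {T T' S S' : Type*}
    [AddCommGroup T] [Module ℝ T] [TopologicalSpace T]
    [AddCommGroup T'] [Module ℝ T'] [TopologicalSpace T']
    [AddCommGroup S] [Module ℝ S] [TopologicalSpace S]
    [AddCommGroup S'] [Module ℝ S'] [TopologicalSpace S']
    {L : S →L[ℝ] T} {L' : S' →L[ℝ] T'} {P : Submodule ℝ S} {P' : Submodule ℝ S'}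
    {δ : S [⋀^Fin 2]→L[ℝ] ℝ} {δ' : S' [⋀^Fin 2]→L[ℝ] ℝ} {K : T →L[ℝ] T} {K' : T' →L[ℝ] T'}
    {A : T →L[ℝ] T'} {C : S →L[ℝ] S'} (hA : Function.Injective A) (hC : Function.Bijective C)
    (hL : ∀ u, A (L u) = L' (C u)) (hP : ∀ u, u ∈ P ↔ C u ∈ P')
    (hδ : ∀ u w, δ ![u, w] = δ' ![C u, C w]) (hK : ∀ v, A (K v) = K' (A v)) :
    IsConvexAlong L P δ K ↔ IsConvexAlong L' P' δ' K' := by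
  simp only [IsConvexAlong, hC.surjective.forall, hC.surjective.exists, ← hP, ← hδ, ← hL, ← hK,
    hA.eq_iff, map_ne_zero_iff C hC.injective]

variable {F : Type*} [NormedAddCommGroup F] [NormedSpace ℝ F] {M : Type*} [TopologicalSpace M]
  [ChartedSpace F M] [IsManifold 𝓘(ℝ, F) ∞ M] {E : Type*} [NormedAddCommGroup E]
  [NormedSpace ℝ E] {H : Type*} [TopologicalSpace H] {I : ModelWithCorners ℝ E H} {N : Type*}
  [TopologicalSpace N] [ChartedSpace H N] [IsManifold I ∞ N] {ι : M → N}
  {α : DForm 𝓘(ℝ, F) M 1} {P : ∀ x : M, Submodule ℝ (TangentSpace 𝓘(ℝ, F) x)}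

lemma isConvexAlong_mfderiv_iff (hα : α.IsSmooth) (hP : ∀ x v, v ∈ P x ↔ α x ![v] = 0) {x₀ x : M}
    (hι : MDifferentiableAt 𝓘(ℝ, F) I ι x) (hx : x ∈ (extChartAt 𝓘(ℝ, F) x₀).source)
    (hιx : ι x ∈ (extChartAt I (ι x₀)).source)
    (hg : DifferentiableAt ℝ (writtenInExtChartAt 𝓘(ℝ, F) I x₀ ι) (extChartAt 𝓘(ℝ, F) x₀ x))
    {K : TangentSpace I (ι x) →L[ℝ] TangentSpace I (ι x)} {K' : E →L[ℝ] E}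
    (hK : ∀ v, mfderiv I 𝓘(ℝ, E) (extChartAt I (ι x₀)) (ι x) (K v) =
      K' (mfderiv I 𝓘(ℝ, E) (extChartAt I (ι x₀)) (ι x) v)) :
    IsConvexAlong (mfderiv 𝓘(ℝ, F) I ι x) (P x) (α.d x) K ↔
      IsConvexAlong (fderiv ℝ (writtenInExtChartAt 𝓘(ℝ, F) I x₀ ι) (extChartAt 𝓘(ℝ, F) x₀ x))
        (oneForm (α.inChart x₀ (extChartAt 𝓘(ℝ, F) x₀ x))).ker
        (extDeriv (α.inChart x₀) (extChartAt 𝓘(ℝ, F) x₀ x)) K' := by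
  have : IsManifold 𝓘(ℝ, F) 1 M := IsManifold.of_le (n := ∞) (by simp)
  have : IsManifold I 1 N := IsManifold.of_le (n := ∞) (by simp)
  refine isConvexAlong_iff_of_conj (mfderiv_extChartAt_injective hιx)
    (isInvertible_mfderiv_extChartAt hx).bijective
    (mfderiv_extChartAt_mfderiv hι hx hιx hg) (fun v => ?_) (hα.d_one_apply hx) hK
  rw [hP, α.one_apply_eq_inChart hx]
  exact Eq.congr_left (oneForm_apply (α.inChart x₀ _) _).symm

lemma continuousAt_extDeriv {m : ℕ} {τ : F → F [⋀^Fin m]→L[ℝ] ℝ} {y : F}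
    (hτ : ContDiffAt ℝ ∞ τ y) : ContinuousAt (extDeriv τ) y :=
  (ContinuousAlternatingMap.alternatizeUncurryFinCLM ℝ F ℝ).continuous.continuousAt.comp
    (hτ.continuousAt_fderiv (by simp))

variable [FiniteDimensional ℝ F] [FiniteDimensional ℝ E]

lemma exists_contDiffAt_isConvexAlong_mfderiv (hι : ContMDiff 𝓘(ℝ, F) I ∞ ι) (hα : α.IsSmooth)
    (hP : ∀ x v, v ∈ P x ↔ α x ![v] = 0) {x₀ : M} (hα₀ : α x₀ ≠ 0)
    (hinj : Function.Injective (mfderiv 𝓘(ℝ, F) I ι x₀))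
    {K : TangentSpace I (ι x₀) →L[ℝ] TangentSpace I (ι x₀)}
    (hK : IsConvexAlong (mfderiv 𝓘(ℝ, F) I ι x₀) (P x₀) (α.d x₀) K) :
    ∃ κ : F → E →L[ℝ] E, (∀ᶠ y in 𝓝 (extChartAt 𝓘(ℝ, F) x₀ x₀), ContDiffAt ℝ ∞ κ y) ∧
      κ (extChartAt 𝓘(ℝ, F) x₀ x₀) = K ∧
      ∀ᶠ x in 𝓝 x₀, ∀ K' : TangentSpace I (ι x) →L[ℝ] TangentSpace I (ι x),
        (∀ v, mfderiv I 𝓘(ℝ, E) (extChartAt I (ι x₀)) (ι x) (K' v) =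
          κ (extChartAt 𝓘(ℝ, F) x₀ x) (mfderiv I 𝓘(ℝ, E) (extChartAt I (ι x₀)) (ι x) v)) →
        IsConvexAlong (mfderiv 𝓘(ℝ, F) I ι x) (P x) (α.d x) K' := by
  have : IsManifold 𝓘(ℝ, F) 1 M := IsManifold.of_le (n := ∞) (by simp)
  have : IsManifold I 1 N := IsManifold.of_le (n := ∞) (by simp)
  have hιd : MDifferentiable 𝓘(ℝ, F) I ι := hι.mdifferentiable (by simp)
  have hg := eventually_contDiffAt_writtenInExtChartAt hι x₀
  have hform : ∀ᶠ y in 𝓝 (extChartAt 𝓘(ℝ, F) x₀ x₀), ContDiffAt ℝ ∞ (α.inChart x₀) y := by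
    filter_upwards [extChartAt_target_mem_nhds x₀] with y hy
    exact hα.contDiffAt_inChart hy
  have hself : mfderiv 𝓘(ℝ, F) I ι x₀ =
      fderiv ℝ (writtenInExtChartAt 𝓘(ℝ, F) I x₀ ι) (extChartAt 𝓘(ℝ, F) x₀ x₀) := by
    rw [(hιd x₀).mfderiv, modelWithCornersSelf_coe, range_id, fderivWithin_univ]
  have hα₀' : oneForm (α.inChart x₀ (extChartAt 𝓘(ℝ, F) x₀ x₀)) ≠ 0 := fun h => hα₀ <| by
    rw [α.eq_inChart_comp (mem_extChartAt_source x₀), oneForm.map_eq_zero_iff.1 h]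
    rfl
  have hK₀ := (isConvexAlong_mfderiv_iff hα hP (hιd x₀) (mem_extChartAt_source x₀)
    (mem_extChartAt_source (ι x₀)) (hg.self_of_nhds.differentiableAt (by simp))
    (K := K) (K' := K) fun v => by rw [mfderiv_extChartAt_self]; rfl).1 hK
  obtain ⟨κ, hκ, hκ₀, hκc⟩ := exists_contDiffAt_isConvexAlong_ker
    (hg.mono fun y hy => hy.fderiv_right (by simp))
    (hform.mono fun y hy => oneForm.comp_contDiffAt_iff.2 hy)
    (continuousAt_extDeriv hform.self_of_nhds) (hself ▸ hinj) hα₀' hK₀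
  have hchart := (continuousAt_extChartAt (I := 𝓘(ℝ, F)) x₀).eventually (hg.and hκc)
  refine ⟨κ, hκ, hκ₀, ?_⟩
  filter_upwards [hchart, extChartAt_source_mem_nhds (I := 𝓘(ℝ, F)) x₀,
    hι.continuous.continuousAt.eventually_mem (extChartAt_source_mem_nhds (I := I) (ι x₀))]
    with x ⟨hgx, hκx⟩ hx hιx K' hK'
  exact (isConvexAlong_mfderiv_iff hα hP (hιd x) hx hιx (hgx.differentiableAt (by simp)) hK').2 hκx

lemma exists_contMDiffOn_endSection_isConvexAlong (hι : Manifold.IsSmoothEmbedding 𝓘(ℝ, F) I ∞ ι)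
    (hα : α.IsSmooth) (hP : ∀ x v, v ∈ P x ↔ α x ![v] = 0) {Ω : DForm I N 2} (hΩ : Ω.IsSmooth)
    {x₀ : M} (hα₀ : α x₀ ≠ 0) {K : TangentSpace I (ι x₀) →L[ℝ] TangentSpace I (ι x₀)}
    (hKΩ : ∀ v, v ≠ 0 → 0 < Ω (ι x₀) ![v, K v])
    (hK : IsConvexAlong (mfderiv 𝓘(ℝ, F) I ι x₀) (P x₀) (α.d x₀) K) :
    ∃ s : ∀ p : N, TangentSpace I p →L[ℝ] TangentSpace I p, ∃ U ∈ 𝓝 (ι x₀),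
      ContMDiffOn I (I.prod 𝓘(ℝ, E →L[ℝ] E)) ∞ (endSection s) U ∧
      (∀ p ∈ U, ∀ v, v ≠ 0 → 0 < Ω p ![v, s p v]) ∧
      ∀ x, ι x ∈ U → IsConvexAlong (mfderiv 𝓘(ℝ, F) I ι x) (P x) (α.d x) (s (ι x)) := by
  have : IsManifold I 1 N := IsManifold.of_le (n := ∞) (by simp)
  have hιx₀ := hι.isImmersion.isImmersionAt x₀
  obtain ⟨κ, hκ, hκ₀, hκc⟩ := exists_contDiffAt_isConvexAlong_mfderiv hι.contMDiff hα hP hα₀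
    (mfderiv_injective_of_isImmersionAt hιx₀ (by simp)) hK
  obtain ⟨r, hr, hrι⟩ := exists_contMDiffAt_leftInverse_of_isImmersionAt hιx₀
  have hr₀ : r (ι x₀) = x₀ := hrι.self_of_nhds
  have hrc : Filter.Tendsto r (𝓝 (ι x₀)) (𝓝 x₀) := by
    have := hr.self_of_nhds.continuousAt
    rwa [ContinuousAt, hr₀] at this
  have hκr : ∀ᶠ p in 𝓝 (ι x₀),
      ContMDiffAt I 𝓘(ℝ, E →L[ℝ] E) ∞ (fun p => κ (extChartAt 𝓘(ℝ, F) x₀ (r p))) p := by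
    filter_upwards [hr, hrc.eventually ((continuousAt_extChartAt x₀).eventually hκ),
      hrc.eventually (chart_source_mem_nhds F x₀)] with p hrp hκp hp
    exact hκp.contMDiffAt.comp p ((contMDiffAt_extChartAt' hp).comp p hrp)
  obtain ⟨s, U, hU, hs, hsΩ, hsκ⟩ := exists_contMDiffOn_endSection_tame hΩ hκr fun v hv => by
    rw [hr₀, hκ₀]
    exact (hKΩ v hv).trans_eq (Ω.inChart_self_two_apply (ι x₀) v (K v)).symm
  have hnear := hrι.and hκc
  rw [hι.isEmbedding.isInducing.nhds_eq_comap] at hnear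
  obtain ⟨U', hU', hnear⟩ := Filter.mem_comap.1 hnear
  refine ⟨s, U ∩ U', Filter.inter_mem hU hU', hs.mono inter_subset_left,
    fun p hp => hsΩ p hp.1, fun x hx => ?_⟩
  obtain ⟨hrx, hconv⟩ := hnear hx.2
  have hsx := (hsκ _ hx.1).2
  rw [hrx] at hsx
  exact hconv _ hsx

end ConvexFields

section ConvexTame

variable {F : Type*} [NormedAddCommGroup F] [NormedSpace ℝ F] {M : Type*} [TopologicalSpace M]
  [ChartedSpace F M] {E : Type*} [NormedAddCommGroup E] [NormedSpace ℝ E] {H : Type*}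
  [TopologicalSpace H] {I : ModelWithCorners ℝ E H} {N : Type*} [TopologicalSpace N]
  [ChartedSpace H N]

lemma pullback_two_apply (ι : M → N) (Ω : DForm I N 2) (x : M) (v w : TangentSpace 𝓘(ℝ, F) x) :
    DForm.pullback (I' := 𝓘(ℝ, F)) ι Ω x ![v, w] =
      Ω (ι x) ![mfderiv 𝓘(ℝ, F) I ι x v, mfderiv 𝓘(ℝ, F) I ι x w] :=
  congrArg (Ω (ι x)) (by ext i; fin_cases i <;> rfl)

/-- The endomorphisms of the tangent space of `N` at `p` which are tamed by `Ω` and, if `p` lies on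
the hypersurface `ι`, satisfy there the pseudoconvexity condition `IsConvexAlong` for `dα`. -/
def convexTame (ι : M → N) (Ω : DForm I N 2) (α : DForm 𝓘(ℝ, F) M 1)
    (P : ∀ x : M, Submodule ℝ (TangentSpace 𝓘(ℝ, F) x)) (p : N) :
    Set (TangentSpace I p →L[ℝ] TangentSpace I p) :=
  {K | (∀ v, v ≠ 0 → 0 < Ω p ![v, K v]) ∧
    ∀ (x : M) (hx : p = ι x), IsConvexAlong (mfderiv 𝓘(ℝ, F) I ι x) (P x) (α.d x) (hx ▸ K)}

lemma convex_convexTame (ι : M → N) (Ω : DForm I N 2) (α : DForm 𝓘(ℝ, F) M 1)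
    (P : ∀ x : M, Submodule ℝ (TangentSpace 𝓘(ℝ, F) x)) (p : N) :
    Convex ℝ (convexTame ι Ω α P p) := by
  rintro K ⟨hK, hKc⟩ K' ⟨hK', hKc'⟩ a b ha hb hab
  refine ⟨convex_setOf_forall_pos (Ω p) hK hK' ha hb hab, ?_⟩
  rintro x rfl
  exact convex_setOf_isConvexAlong (mfderiv 𝓘(ℝ, F) I ι x) (P x) (α.d x)
    (hKc x rfl) (hKc' x rfl) ha hb hab

end ConvexTame

section GlobalFields

variable {F : Type*} [NormedAddCommGroup F] [NormedSpace ℝ F] [FiniteDimensional ℝ F]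
  {M : Type*} [TopologicalSpace M] [ChartedSpace F M] [IsManifold 𝓘(ℝ, F) ∞ M]
  {E : Type*} [NormedAddCommGroup E] [InnerProductSpace ℝ E] [FiniteDimensional ℝ E]
  {H : Type*} [TopologicalSpace H] {I : ModelWithCorners ℝ E H}
  {N : Type*} [TopologicalSpace N] [ChartedSpace H N] [IsManifold I ∞ N]
  {ι : M → N} {Ω : DForm I N 2} {α : DForm 𝓘(ℝ, F) M 1}
  {P : ∀ x : M, Submodule ℝ (TangentSpace 𝓘(ℝ, F) x)}

lemma exists_contMDiffOn_endSection_of_nondegenerate (hΩ : Ω.IsSmooth) {p₀ : N}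
    (hΩ₀ : NondegenerateOn (Ω p₀) ⊤) :
    ∃ s : ∀ p : N, TangentSpace I p →L[ℝ] TangentSpace I p, ∃ U ∈ 𝓝 p₀,
      ContMDiffOn I (I.prod 𝓘(ℝ, E →L[ℝ] E)) ∞ (endSection s) U ∧
      ∀ p ∈ U, ∀ v, v ≠ 0 → 0 < Ω p ![v, s p v] := by
  have : IsManifold I 1 N := IsManifold.of_le (n := ∞) (by simp)
  obtain ⟨K, hK, -⟩ := exists_tame_preserving (isAlt_altBilin (T := E) (Ω p₀))
    (fun v hv => hΩ₀ v trivial fun w _ => hv w) ⊥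
    (B₁ := 0) (fun _ _ v _ => Subsingleton.elim _ _)
  obtain ⟨s, U, hU, hs, hsΩ, -⟩ := exists_contMDiffOn_endSection_tame hΩ (κ := fun _ => K)
    (Filter.Eventually.of_forall fun _ => contMDiffAt_const) fun v hv =>
      (hK v hv).trans_eq (Ω.inChart_self_two_apply p₀ v (K v)).symm
  exact ⟨s, U, hU, hs, hsΩ⟩

lemma exists_contMDiffOn_endSection_mem_convexTame
    (hι : Manifold.IsSmoothEmbedding 𝓘(ℝ, F) I ∞ ι) (hιc : IsClosed (range ι)) (hα : α.IsSmooth)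
    (hα₀ : ∀ x, α x ≠ 0) (hP : ∀ x v, v ∈ P x ↔ α x ![v] = 0) (hΩ : Ω.IsSmooth)
    (hΩn : ∀ p, NondegenerateOn (Ω p) ⊤)
    (hseg : ∀ x, ∀ b ∈ segment ℝ (DForm.pullback (I' := 𝓘(ℝ, F)) ι Ω x) (α.d x),
      NondegenerateOn b (P x)) (p₀ : N) :
    ∃ U ∈ 𝓝 p₀, ∃ s : ∀ p : N, TangentSpace I p →L[ℝ] TangentSpace I p,
      ContMDiffOn I (I.prod 𝓘(ℝ, E →L[ℝ] E)) ∞ (endSection s) U ∧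
      ∀ p ∈ U, s p ∈ convexTame ι Ω α P p := by
  by_cases hp₀ : p₀ ∈ range ι
  · obtain ⟨x₀, rfl⟩ := hp₀
    obtain ⟨K, hKΩ, hK⟩ := exists_tame_isConvexAlong (E := E) (F := F)
      (mfderiv_injective_of_isImmersionAt (hι.isImmersion.isImmersionAt x₀) (by simp))
      (hΩn (ι x₀)) (hseg x₀)
    obtain ⟨s, U, hU, hs, hsΩ, hsc⟩ :=
      exists_contMDiffOn_endSection_isConvexAlong hι hα hP hΩ (hα₀ x₀) hKΩ hK
    refine ⟨U, hU, s, hs, fun p hp => ⟨hsΩ p hp, ?_⟩⟩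
    rintro x rfl
    exact hsc x hp
  · obtain ⟨s, U, hU, hs, hsΩ⟩ := exists_contMDiffOn_endSection_of_nondegenerate hΩ (hΩn p₀)
    refine ⟨U ∩ (range ι)ᶜ, Filter.inter_mem hU (hιc.isOpen_compl.mem_nhds hp₀), s,
      hs.mono inter_subset_left, fun p hp => ⟨hsΩ p hp.1, ?_⟩⟩
    rintro x rfl
    exact absurd ⟨x, rfl⟩ hp.2

lemma exists_contMDiff_endSection_mem_convexTame [T2Space N] [SigmaCompactSpace N]
    (hι : Manifold.IsSmoothEmbedding 𝓘(ℝ, F) I ∞ ι) (hιc : IsClosed (range ι)) (hα : α.IsSmooth)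
    (hα₀ : ∀ x, α x ≠ 0) (hP : ∀ x v, v ∈ P x ↔ α x ![v] = 0) (hΩ : Ω.IsSmooth)
    (hΩn : ∀ p, NondegenerateOn (Ω p) ⊤)
    (hseg : ∀ x, ∀ b ∈ segment ℝ (DForm.pullback (I' := 𝓘(ℝ, F)) ι Ω x) (α.d x),
      NondegenerateOn b (P x)) :
    ∃ K : ∀ p : N, TangentSpace I p →L[ℝ] TangentSpace I p,
      ContMDiff I (I.prod 𝓘(ℝ, E →L[ℝ] E)) ∞ (endSection K) ∧ ∀ p, K p ∈ convexTame ι Ω α P p := by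
  have : IsManifold I 1 N := IsManifold.of_le (n := ∞) (by simp)
  obtain ⟨s, hs⟩ := exists_contMDiffSection_forall_mem_convex_of_local I (n := ⊤)
    (F_fiber := E →L[ℝ] E) (fun p : N => TangentSpace I p →L[ℝ] TangentSpace I p)
    (convexTame ι Ω α P) (convex_convexTame ι Ω α P)
    (exists_contMDiffOn_endSection_mem_convexTame hι hιc hα hα₀ hP hΩ hΩn hseg)
  exact ⟨s, s.contMDiff, hs⟩

theorem exists_isAlmostComplexStructure_isConvexAlong [T2Space N] [SigmaCompactSpace N]
    (hι : Manifold.IsSmoothEmbedding 𝓘(ℝ, F) I ∞ ι) (hιc : IsClosed (range ι)) (hα : α.IsSmooth)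
    (hα₀ : ∀ x, α x ≠ 0) (hP : ∀ x v, v ∈ P x ↔ α x ![v] = 0) (hΩ : Ω.IsSmooth)
    (hΩn : ∀ p, NondegenerateOn (Ω p) ⊤)
    (hseg : ∀ x, ∀ b ∈ segment ℝ (DForm.pullback (I' := 𝓘(ℝ, F)) ι Ω x) (α.d x),
      NondegenerateOn b (P x)) :
    ∃ J : ∀ p : N, TangentSpace I p →L[ℝ] TangentSpace I p, IsAlmostComplexStructure J ∧
      IsTamedBy J Ω ∧
      ∀ x, IsConvexAlong (mfderiv 𝓘(ℝ, F) I ι x) (P x) (α.d x) (J (ι x)) := by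
  obtain ⟨K, hKs, hK⟩ :=
    exists_contMDiff_endSection_mem_convexTame hι hιc hα hα₀ hP hΩ hΩn hseg
  have hrot : ∀ p, IsRotatable (A := E →L[ℝ] E) (K p) := fun p =>
    isRotatable_of_tame (E := E) (isAlt_altBilin (T := E) (Ω p)) (hK p).1
  refine ⟨fun p => rotAvg (A := E →L[ℝ] E) (K p), ⟨contMDiff_endSection_rotAvg hKs hrot,
    fun p v => DFunLike.congr_fun (hrot p).rotAvg_mul_self v⟩, fun p v hv => ?_, fun x => ?_⟩
  · exact IsRotatable.rotAvg_tame (E := E) (hrot p) (S := ⊤) (fun _ _ => trivial)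
      (isAlt_altBilin (T := E) (Ω p)) (fun v _ hv => (hK p).1 v hv) trivial hv
  · exact IsRotatable.isConvexAlong_rotAvg (E := E) (F := F) (hrot (ι x))
      (mfderiv_injective_of_isImmersionAt (hι.isImmersion.isImmersionAt x) (by simp))
      ((hK (ι x)).2 x rfl)

end GlobalFields

section ContactBoundary

lemma map_eq_range_inf_map {E F : Type*} [AddCommGroup E] [Module ℝ E] [AddCommGroup F] [Module ℝ F]
    {L : F →ₗ[ℝ] E} {J : E →ₗ[ℝ] E} (hJ : ∀ v, J (J v) = -v) {P : Submodule ℝ F} {a : F →ₗ[ℝ] ℝ}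
    (ha : ∀ v, v ∈ P ↔ a v = 0) (h : ∀ v ∈ P, ∃ w ∈ P, L w = J (L v)) :
    P.map L = L.range ⊓ L.range.map J := by
  apply le_antisymm
  · rintro _ ⟨v, hv, rfl⟩
    refine ⟨⟨v, rfl⟩, ?_⟩
    obtain ⟨w, -, hwJ⟩ := h v hv
    refine ⟨L (-w), ⟨_, rfl⟩, ?_⟩
    rw [map_neg, map_neg, hwJ, hJ, neg_neg]
  · rintro _ ⟨⟨x, rfl⟩, ⟨_, ⟨y, rfl⟩, hy⟩⟩
    by_cases hx : a x = 0
    · exact ⟨x, (ha x).2 hx, rfl⟩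
    -- For `v = y - c • x ∈ P`, the vector `J (L v) - c • L v = (1 + c ^ 2) • L x` lies in `L P`.
    let c := a y / a x
    have hp : y - c • x ∈ P := (ha _).2 (by simp [c, hx])
    obtain ⟨w, hw, hwJ⟩ := h _ hp
    have hJx : J (L x) = -L y := by rw [← hy, hJ]
    have hLw : L w = L x + c • L y := by
      rw [hwJ, map_sub, map_sub, map_smul, map_smul, hy, hJx, smul_neg, sub_neg_eq_add]
    have hLx : (1 + c ^ 2) • L x = L (w - c • (y - c • x)) := by
      simp only [map_sub, map_smul, hLw]
      module
    refine ⟨(1 + c ^ 2)⁻¹ • (w - c • (y - c • x)),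
      P.smul_mem _ (P.sub_mem hw (P.smul_mem _ hp)), ?_⟩
    rw [map_smul, ← hLx, inv_smul_smul₀ (by positivity)]

variable {k : ℕ} {V : Type*} [TopologicalSpace V]
  [ChartedSpace (EuclideanSpace ℝ (Fin (2 * k + 1))) V]
  {W : Type*} [TopologicalSpace W] [ChartedSpace (EuclideanHalfSpace (2 * k + 2)) W]
  {ι : V → W} {Ω : DForm (𝓡∂ (2 * k + 2)) W 2} {ξ : ContactStructure k V}
  {J : ∀ p : W, TangentSpace (𝓡∂ (2 * k + 2)) p →L[ℝ] TangentSpace (𝓡∂ (2 * k + 2)) p}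

lemma isOrientedBoundary_isComplexPositive_iff (hJ : ∀ p v, J p (J p v) = -v)
    (hJΩ : IsTamedBy J Ω) :
    IsOrientedBoundary ι ξ (fun p e => IsComplexPositive k (J p) e) ↔
      IsOrientedBoundary ι ξ fun p e => 0 < symplecticVolume k (Ω p) e := by
  have h : ∀ p e, IsComplexPositive k (J p) e ↔ 0 < symplecticVolume k (Ω p) e := fun p e => by
    have : FiniteDimensional ℝ (TangentSpace (𝓡∂ (2 * k + 2)) p) :=
      inferInstanceAs (FiniteDimensional ℝ (EuclideanSpace ℝ (Fin (2 * k + 2))))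
    exact isComplexPositive_iff_symplecticVolume_pos
      (finrank_euclideanSpace_fin (𝕜 := ℝ) (n := 2 * k + 2)) (hJ p) (hJΩ p) e
  simp only [h]

lemma ContactStructure.exists_isContactForm (ξ : ContactStructure k V) :
    ∃ α, ξ.IsContactForm α ∧ (∀ x, α x ≠ 0) ∧ ∀ x, NondegenerateOn (α.d x) (ξ.plane x) := by
  obtain ⟨α, hαs, hα₀, hαp, hαo, hαd⟩ := ξ.exists_form
  exact ⟨α, ⟨hαs, hαp, hαo⟩, hα₀, hαd⟩

lemma IsTamedPseudoconvexBoundary.isWeakFilling (h : IsTamedPseudoconvexBoundary ι J ξ)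
    (hι : IsBoundaryIdentification (k := k) ι) (hJ : ∀ p v, J p (J p v) = -v)
    (hJΩ : IsTamedBy J Ω) : IsWeakFilling ι Ω ξ := by
  have hpos : ∀ l, ξ.IsContactForm l → ∀ x, ∀ v ∈ ξ.plane x, v ≠ 0 → ∃ w ∈ ξ.plane x,
      0 < DForm.pullback (I' := 𝓡 (2 * k + 1)) ι Ω x ![v, w] ∧ 0 < l.d x ![v, w] := by
    intro l hl x v hv hv0
    obtain ⟨w, hw, hwJ, hlw⟩ := h.convex l hl x v hv hv0
    have hinj : Function.Injective (mfderiv (𝓡 (2 * k + 1)) (𝓡∂ (2 * k + 2)) ι x) :=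
      mfderiv_injective_of_isImmersionAt
        (hι.isSmoothEmbedding.isImmersion.isImmersionAt x) (by simp)
    refine ⟨w, hw, ?_, hlw⟩
    rw [pullback_two_apply, hwJ]
    exact hJΩ _ _ ((map_ne_zero_iff _ hinj).2 hv0)
  refine ⟨(isOrientedBoundary_isComplexPositive_iff hJ hJΩ).1 h.oriented, fun x v hv hvw => ?_,
    fun l hl x v hv hvw => ?_⟩
  · by_contra hv0
    obtain ⟨α, hα, -⟩ := ξ.exists_isContactForm
    obtain ⟨w, hw, hΩw, -⟩ := hpos α hα x v hv hv0
    exact hΩw.ne' (hvw w hw)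
  · by_contra hv0
    obtain ⟨w, hw, hΩw, hlw⟩ := hpos l hl x v hv hv0
    exact (add_pos hΩw hlw).ne' (hvw w hw)

lemma IsWeakFilling.nondegenerateOn_of_mem_segment (h : IsWeakFilling ι Ω ξ)
    {α : DForm (𝓡 (2 * k + 1)) V 1} (hα : ξ.IsContactForm α) {x : V}
    (hαd : NondegenerateOn (α.d x) (ξ.plane x)) :
    ∀ b ∈ segment ℝ (DForm.pullback (I' := 𝓡 (2 * k + 1)) ι Ω x) (α.d x),
      NondegenerateOn b (ξ.plane x) := by
  rintro _ ⟨s, t, hs, ht, hst, rfl⟩ v hv hvw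
  obtain rfl | hs := hs.eq_or_lt
  · rw [zero_add] at hst
    refine hαd v hv fun w hw => ?_
    simpa [hst] using hvw w hw
  obtain rfl | ht := ht.eq_or_lt
  · rw [add_zero] at hst
    refine h.nondegenerate x v hv fun w hw => ?_
    simpa [hst] using hvw w hw
  -- `s Ω + t dα = s (Ω + d((t / s) α))`.
  refine h.nondegenerate_add _ (hα.const_smul (div_pos ht hs)) x v hv fun w hw => ?_
  rw [DForm.d_smul]
  refine (mul_eq_zero_iff_left hs.ne').1 (Eq.trans ?_ (hvw w hw))
  simp only [Nat.reduceAdd, ContinuousAlternatingMap.add_apply, ContinuousAlternatingMap.coe_smul,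
    Pi.smul_apply, smul_eq_mul]
  field_simp

variable [IsManifold (𝓡 (2 * k + 1)) ∞ V]

lemma IsTamedPseudoconvexBoundary.of_isConvexAlong (hΩ : IsSymplecticForm Ω)
    (hJ : ∀ p v, J p (J p v) = -v) (hJΩ : IsTamedBy J Ω)
    (hor : IsOrientedBoundary ι ξ fun p e => 0 < symplecticVolume k (Ω p) e)
    {α : DForm (𝓡 (2 * k + 1)) V 1} (hα : ξ.IsContactForm α)
    (hJα : ∀ x, IsConvexAlong (mfderiv (𝓡 (2 * k + 1)) (𝓡∂ (2 * k + 2)) ι x) (ξ.plane x) (α.d x)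
      (J (ι x))) :
    IsTamedPseudoconvexBoundary ι J ξ := by
  refine ⟨(isOrientedBoundary_isComplexPositive_iff hJ hJΩ).2 hor, fun x => ?_, ⟨Ω, hΩ, hJΩ⟩,
    fun l hl x v hv hv0 => ?_⟩
  · refine map_eq_range_inf_map (hJ (ι x)) (a := (oneForm (E := EuclideanSpace ℝ (Fin (2 * k + 1)))
      (α x)).toLinearMap) (fun v => ?_) fun v hv => ?_
    · exact (hα.mem_plane_iff x v).trans (Eq.congr_left
        (oneForm_apply (E := EuclideanSpace ℝ (Fin (2 * k + 1))) (α x) v).symm)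
    · obtain rfl | hv0 := eq_or_ne v 0
      · exact ⟨0, zero_mem _, by simp⟩
      · obtain ⟨w, hw, hwJ, -⟩ := hJα x v hv hv0
        exact ⟨w, hw, hwJ⟩
  · obtain ⟨w, hw, hwJ, hαw⟩ := hJα x v hv hv0
    obtain ⟨c, hc, hlα⟩ := hα.exists_d_eq hl x
    exact ⟨w, hw, hwJ, (mul_pos hc hαw).trans_eq (hlα v hv w hw).symm⟩

lemma IsWeakFilling.exists_isTamedPseudoconvexBoundary
    [IsManifold (𝓡∂ (2 * k + 2)) ∞ W] [T2Space W] [SigmaCompactSpace W] (h : IsWeakFilling ι Ω ξ)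
    (hι : IsBoundaryIdentification (k := k) ι) (hΩ : IsSymplecticForm Ω) :
    ∃ J : ∀ p : W, TangentSpace (𝓡∂ (2 * k + 2)) p →L[ℝ] TangentSpace (𝓡∂ (2 * k + 2)) p,
      IsAlmostComplexStructure J ∧ IsTamedBy J Ω ∧ IsTamedPseudoconvexBoundary ι J ξ := by
  obtain ⟨α, hα, hα₀, hαd⟩ := ξ.exists_isContactForm
  have hιc : IsClosed (range ι) := by
    have : IsManifold (𝓡∂ (2 * k + 2)) 1 W := IsManifold.of_le (n := ∞) (by simp)
    rw [hι.range_eq]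
    exact ModelWithCorners.isClosed_boundary (n := 1) (by simp)
  obtain ⟨J, hJ, hJΩ, hJα⟩ := exists_isAlmostComplexStructure_isConvexAlong hι.isSmoothEmbedding
    hιc hα.smooth hα₀ hα.mem_plane_iff hΩ.smooth hΩ.nondegenerate
    fun x => h.nondegenerateOn_of_mem_segment hα (hαd x)
  exact ⟨J, hJ, hJΩ, .of_isConvexAlong hΩ hJ.sq_eq_neg hJΩ h.oriented hα hJα⟩

end ContactBoundary

end

theorem theoremD_general {k : ℕ}
    {V : Type*} [TopologicalSpace V]
    [ChartedSpace (EuclideanSpace ℝ (Fin (2 * k + 1))) V] [IsManifold (𝓡 (2 * k + 1)) ∞ V]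
    {W : Type*} [TopologicalSpace W] [T2Space W] [SigmaCompactSpace W]
    [ChartedSpace (EuclideanHalfSpace (2 * k + 2)) W] [IsManifold (𝓡∂ (2 * k + 2)) ∞ W]
    (ι : V → W) (hι : IsBoundaryIdentification (k := k) ι)
    (Ω : DForm (𝓡∂ (2 * k + 2)) W 2) (hΩ : IsSymplecticForm Ω)
    (ξ : ContactStructure k V) :
    IsWeakFilling ι Ω ξ ↔
      ∃ J : ∀ p : W, TangentSpace (𝓡∂ (2 * k + 2)) p →L[ℝ] TangentSpace (𝓡∂ (2 * k + 2)) p,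
        IsAlmostComplexStructure J ∧ IsTamedBy J Ω ∧ IsTamedPseudoconvexBoundary ι J ξ :=
  ⟨fun h => h.exists_isTamedPseudoconvexBoundary hι hΩ,
    fun ⟨_, hJ, hJΩ, hJξ⟩ => hJξ.isWeakFilling hι hJ.sq_eq_neg hJΩ⟩

theorem theoremD (k : ℕ) (hk : 1 ≤ k)
    {V : Type*} [TopologicalSpace V] [T2Space V] [CompactSpace V]
    [ChartedSpace (EuclideanSpace ℝ (Fin (2 * k + 1))) V] [IsManifold (𝓡 (2 * k + 1)) ∞ V]
    {W : Type*} [TopologicalSpace W] [T2Space W] [CompactSpace W]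
    [ChartedSpace (EuclideanHalfSpace (2 * k + 2)) W] [IsManifold (𝓡∂ (2 * k + 2)) ∞ W]
    (ι : V → W) (hι : IsBoundaryIdentification (k := k) ι)
    (Ω : DForm (𝓡∂ (2 * k + 2)) W 2) (hΩ : IsSymplecticForm Ω)
    (ξ : ContactStructure k V) :
    IsWeakFilling ι Ω ξ ↔
      ∃ J : ∀ p : W, TangentSpace (𝓡∂ (2 * k + 2)) p →L[ℝ] TangentSpace (𝓡∂ (2 * k + 2)) p,
        IsAlmostComplexStructure J ∧ IsTamedBy J Ω ∧ IsTamedPseudoconvexBoundary ι J ξ :=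
  theoremD_general ι hι Ω hΩ ξ
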